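/- For $m\ge 1$ and matrices $T_1,\dots,T_m\in M_n(\mathbb C)$ let $$\sigma_p(T_1,\dots,T_m)=\{(x_1,\dots,x_m)\in\mathbb C^m:\ x_1T_1+\dots+x_mT_m-I \text{ is not invertible}\}.$$ A matrix $h\in M_n(\mathbb C)$ is a complex Hadamard matrix if all its entries have modulus one and its rows are mutually orthogonal. Let $F_n=[e^{2\pi i jk/n}]_{j,k=0}^{n-1}$ and $D_n=\mathrm{diag}(1,e^{2\pi i/n},\dots,e^{2\pi i(n-1)/n})$. A matrix $h$ is of Fourier type if $h=\Lambda_1P_1F_nP_2\Lambda_2$ with diagonal matrices $\Lambda_1,\Lambda_2$ with unimodular diagonal entries and permutation matrices $P_1,P_2$; every such $h$ is a complex Hadamard matrix. **Theorem.** Let $A,B$ be complex $n\times n$ matrices such that $A$ is normal, $\|B\|=1$ (operator norm with respect to the Euclidean norm on $\mathbb C^n$), and $$\sigma_p(A,B,AB)=\{(x,y,z)\in\mathbb C^3:\ x^n+y^n+(-1)^{n-1}z^n=1\}.$$ Then: 1. $A$ and $B$ are unitary, and the spectrum of each of them is the set of all $n$-th roots of unity, each of (algebraic) multiplicity $1$.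 2. If $e_0,\dots,e_{n-1}$ and $\zeta_0,\dots,\zeta_{n-1}$ are bases of $\mathbb C^n$ consisting of unit vectors with $Ae_j=e^{2\pi ij/n}e_j$ and $B\zeta_j=e^{2\pi ij/n}\zeta_j$ for $j=0,\dots,n-1$, and $C=(c_{jr})$ is the transition matrix between them given by $e_r=\sum_j c_{jr}\zeta_j$, then $\sqrt n\,C$ and $\sqrt n\,C^{-1}$ are complex Hadamard matrices. 3. If $n\in\{3,4,5\}$, then $(A,B)$ is unitarily equivalent to a Hadamard pair of Fourier type: there are a unitary matrix $U$ and a complex Hadamard matrix $h$ of Fourier type with $A=UD_nU^*$ and $B=U\bigl(\tfrac1n h^*D_nh\bigr)U^*$. -/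

import Mathlib

noncomputable section

/-- The proper projective joint spectrum `σ_p` of a tuple of matrices: all points `x` for which
`∑ i, x i • T i - 1` is not invertible. -/
def properJointSpectrum {n : ℕ} {ι : Type} [Fintype ι]
    (T : ι → Matrix (Fin n) (Fin n) ℂ) : Set (ι → ℂ) :=
  {x | ¬ IsUnit (∑ i, x i • T i - 1)}

/-- The Fourier hypersurface `{x ^ n + y ^ n + (-1) ^ (n - 1) z ^ n = 1}` in `ℂ³`. -/
def fourierSurface (n : ℕ) : Set (Fin 3 → ℂ) :=
  {x | x 0 ^ n + x 1 ^ n + (-1) ^ (n - 1) * x 2 ^ n = 1}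

/-- The `n`-th root of unity `e ^ (2 π i j / n)`. -/
def unityRoot (n j : ℕ) : ℂ :=
  Complex.exp (2 * Real.pi * Complex.I * j / n)

/-- A complex Hadamard matrix: unimodular entries and mutually orthogonal rows. -/
def IsComplexHadamard {n : ℕ} (h : Matrix (Fin n) (Fin n) ℂ) : Prop :=
  (∀ i j, ‖h i j‖ = 1) ∧
    ∀ i i', i ≠ i' → ∑ j, h i j * starRingEnd ℂ (h i' j) = 0

/-- The Fourier matrix `F_n`, with rows and columns numbered from `0` to `n - 1`. -/
def fourierMatrix (n : ℕ) : Matrix (Fin n) (Fin n) ℂ :=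
  Matrix.of fun j k => unityRoot n (j * k)

/-- Similarity of Hadamard matrices: `h₂ = Λ₁ P₁ h₁ P₂ Λ₂`, where `Λ₁`, `Λ₂` are unimodular diagonal
matrices and `P₁`, `P₂` are permutation matrices. -/
def HadamardSimilar {n : ℕ} (h₁ h₂ : Matrix (Fin n) (Fin n) ℂ) : Prop :=
  ∃ (l₁ l₂ : Fin n → ℂ) (s₁ s₂ : Equiv.Perm (Fin n)),
    (∀ i, ‖l₁ i‖ = 1) ∧ (∀ i, ‖l₂ i‖ = 1) ∧
      h₂ = Matrix.diagonal l₁ * s₁.permMatrix ℂ * h₁ * s₂.permMatrix ℂ * Matrix.diagonal l₂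

/-- The diagonal matrix with the `n`-th roots of unity on the diagonal, in increasing order of
arguments. -/
def unityDiagonal (n : ℕ) : Matrix (Fin n) (Fin n) ℂ :=
  Matrix.diagonal fun j => unityRoot n j

/-- The second matrix `n⁻¹ hᴴ D h` of the pair generated by `h`; the first one is
`D = unityDiagonal n`. -/
def hadamardPartner {n : ℕ} (h : Matrix (Fin n) (Fin n) ℂ) : Matrix (Fin n) (Fin n) ℂ :=
  (n : ℂ)⁻¹ • (h.conjTranspose * unityDiagonal n * h)

/-- The pairs `(A, B)` and `(A', B')` are unitarily equivalent. -/
def PairUnitarilyEquivalent {n : ℕ} (A B A' B' : Matrix (Fin n) (Fin n) ℂ) : Prop :=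
  ∃ U ∈ Matrix.unitaryGroup (Fin n) ℂ,
    A = U * A' * U.conjTranspose ∧ B = U * B' * U.conjTranspose

end

/-!
The joint spectrum determines the characteristic polynomial of every combination of `A`, `B` and
`A * B`: that of `x A + y B + z A B` is `X ^ n - (x ^ n + y ^ n + (-1) ^ (n - 1) z ^ n)`. In
particular `A ^ n = B ^ n = 1`; a normal matrix, or a contraction, of finite order is unitary.

Let `X` express an eigenbasis of `B` in an eigenbasis of `A`, and `D = diag (λ₀, …, λₙ₋₁)` with the
`n`-th roots of unity. Then `det (X - x D X - y X D - z D X D)` is known for all `x`, `y`, `z`.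
Differentiating in `z` at `x = λₖ⁻¹`, `y = λⱼ⁻¹`, `z = -x y` gives `n |Xₖⱼ| ^ 2 = 1`, so `√n X` is a
complex Hadamard matrix.

In orders three and five every complex Hadamard matrix is of Fourier type. In order five, the
orthogonality relations of three rows and three columns make two even and two odd generalized
diagonals of a block of order three have equal products. Hence, after permuting and rescaling, this
block has rows `(1, 1, 1)`, `(1, a, b)`, `(1, b, a)`, which forces `a` and `b` to be fifth roots of
unity. In order four there is a one-parameter family of complex Hadamard matrices, and the condition
`tr ((A B) ^ 2) = 0`, read off from the characteristic polynomial of `A B`, singles out its Fourier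
members.
-/

section UnityRoot

theorem unityRoot_eq_pow (n j : ℕ) : unityRoot n j = unityRoot n 1 ^ j := by
  rw [unityRoot, unityRoot, ← Complex.exp_nat_mul]
  congr 1
  push_cast
  ring

theorem isPrimitiveRoot_unityRoot {n : ℕ} (hn : n ≠ 0) : IsPrimitiveRoot (unityRoot n 1) n := by
  simpa [unityRoot] using Complex.isPrimitiveRoot_exp n hn

theorem norm_unityRoot (n j : ℕ) : ‖unityRoot n j‖ = 1 := by
  have hangle : (2 * Real.pi * Complex.I * j / n : ℂ)
      = ((2 * Real.pi * j / n : ℝ) : ℂ) * Complex.I := by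
    push_cast
    ring
  rw [unityRoot, hangle, Complex.norm_exp_ofReal_mul_I]

theorem unityRoot_ne_zero (n j : ℕ) : unityRoot n j ≠ 0 :=
  Complex.exp_ne_zero _

theorem unityRoot_pow_eq_one {n : ℕ} (hn : n ≠ 0) (j : ℕ) : unityRoot n j ^ n = 1 := by
  rw [unityRoot_eq_pow, ← pow_mul, mul_comm, pow_mul, (isPrimitiveRoot_unityRoot hn).pow_eq_one,
    one_pow]

theorem unityRoot_injective (n : ℕ) : Function.Injective fun j : Fin n => unityRoot n j := by
  intro j k h
  simp only [unityRoot_eq_pow n j, unityRoot_eq_pow n k] at h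
  exact Fin.ext ((isPrimitiveRoot_unityRoot j.pos.ne').pow_inj j.2 k.2 h)

theorem sum_unityRoot_pow {n m : ℕ} (hm : ¬ n ∣ m) : ∑ j : Fin n, unityRoot n j ^ m = 0 := by
  obtain rfl | hn := eq_or_ne n 0
  · simp
  have hprim := isPrimitiveRoot_unityRoot hn
  have hne : unityRoot n 1 ^ m ≠ 1 := fun h => hm (hprim.dvd_of_pow_eq_one m h)
  have hgeom : (unityRoot n 1 ^ m - 1) * ∑ j ∈ Finset.range n, (unityRoot n 1 ^ m) ^ j = 0 := by
    rw [mul_geom_sum, pow_right_comm, hprim.pow_eq_one, one_pow, sub_self]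
  rw [Fin.sum_univ_eq_sum_range fun j => unityRoot n j ^ m,
    Finset.sum_congr rfl fun j _ => by rw [unityRoot_eq_pow, pow_right_comm]]
  exact (mul_eq_zero.1 hgeom).resolve_left (sub_ne_zero.2 hne)

end UnityRoot

section JointSpectrum

open Matrix Polynomial

variable {n : ℕ} {A B : Matrix (Fin n) (Fin n) ℂ}

theorem eq_X_pow_sub_C_of_isRoot_iff {K : Type*} [Field K] [IsAlgClosed K] {p : K[X]} {s : K}
    (hp : p.Monic) (hdeg : p.natDegree = n) (hn : (n : K) ≠ 0)
    (hroot : ∀ t ≠ 0, p.IsRoot t ↔ t ^ n = s) : p = X ^ n - C s := by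
  have hn' : n ≠ 0 := by rintro rfl; exact hn Nat.cast_zero
  obtain rfl | hs := eq_or_ne s 0
  · have hroots : p.roots = Multiset.replicate n 0 := by
      refine Multiset.eq_replicate.2 ⟨by rw [IsAlgClosed.card_roots_eq_natDegree, hdeg], ?_⟩
      intro t ht
      by_contra ht0
      exact pow_ne_zero n ht0 ((hroot t ht0).1 ((mem_roots hp.ne_zero).1 ht))
    rw [(IsAlgClosed.splits p).eq_prod_roots_of_monic hp, hroots]
    simp
  · have hq : (X ^ n - C s : K[X]).Monic := monic_X_pow_sub_C s hn'
    have hdvd : X ^ n - C s ∣ p := by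
      rw [IsAlgClosed.dvd_iff_roots_le_roots hq.ne_zero hp.ne_zero,
        Multiset.le_iff_subset (nodup_roots (separable_X_pow_sub_C s hn hs))]
      intro t ht
      have hts : t ^ n = s := by simpa [sub_eq_zero, hq.ne_zero] using ht
      have ht0 : t ≠ 0 := by rintro rfl; exact hs (by rw [← hts, zero_pow hn'])
      exact (mem_roots hp.ne_zero).2 ((hroot t ht0).2 hts)
    exact eq_of_monic_of_dvd_of_natDegree_le hq hp hdvd (by rw [hdeg, natDegree_X_pow_sub_C])

theorem isRoot_charpoly_iff_inv_smul_mem_properJointSpectrum {ι : Type} [Fintype ι]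
    (T : ι → Matrix (Fin n) (Fin n) ℂ) (x : ι → ℂ) {t : ℂ} (ht : t ≠ 0) :
    (∑ i, x i • T i).charpoly.IsRoot t ↔ t⁻¹ • x ∈ properJointSpectrum T := by
  have hfactor : algebraMap ℂ _ t - ∑ i, x i • T i
      = Units.mk0 (-t) (neg_ne_zero.2 ht) • (∑ i, (t⁻¹ • x) i • T i - 1) := by
    simp [Units.smul_def, smul_sub, Finset.smul_sum, smul_smul, ht, Algebra.algebraMap_eq_smul_one]
    abel
  rw [← mem_spectrum_iff_isRoot_charpoly, spectrum.mem_iff, hfactor, isUnit_smul_iff]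
  rfl

theorem inv_smul_mem_fourierSurface_iff (x : Fin 3 → ℂ) {t : ℂ} (ht : t ≠ 0) :
    t⁻¹ • x ∈ fourierSurface n ↔ t ^ n = x 0 ^ n + x 1 ^ n + (-1) ^ (n - 1) * x 2 ^ n := by
  have htn : t ^ n ≠ 0 := pow_ne_zero n ht
  simp only [fourierSurface, Set.mem_ofPred_eq, Pi.smul_apply, smul_eq_mul, mul_pow, inv_pow]
  constructor <;> intro h
  · field_simp at h
    exact h.symm
  · field_simp
    exact h.symm

theorem charpoly_eq_of_properJointSpectrum_eq (hn : n ≠ 0)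
    (hσ : properJointSpectrum ![A, B, A * B] = fourierSurface n) (x y z : ℂ) :
    (x • A + y • B + z • (A * B)).charpoly
      = X ^ n - C (x ^ n + y ^ n + (-1) ^ (n - 1) * z ^ n) := by
  refine eq_X_pow_sub_C_of_isRoot_iff (charpoly_monic _) (by simp) (Nat.cast_ne_zero.2 hn) ?_
  intro t ht
  have hroot := isRoot_charpoly_iff_inv_smul_mem_properJointSpectrum ![A, B, A * B] ![x, y, z] ht
  rw [hσ, inv_smul_mem_fourierSurface_iff _ ht] at hroot
  rw [Fin.sum_univ_three] at hroot
  exact hroot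

theorem det_one_sub_eq_of_properJointSpectrum_eq (hn : n ≠ 0)
    (hσ : properJointSpectrum ![A, B, A * B] = fourierSurface n) (x y z : ℂ) :
    (1 - (x • A + y • B + z • (A * B))).det
      = 1 - (x ^ n + y ^ n + (-1) ^ (n - 1) * z ^ n) := by
  simpa [eval_charpoly] using congrArg (eval 1) (charpoly_eq_of_properJointSpectrum_eq hn hσ x y z)

end JointSpectrum

section Charpoly

open Matrix Polynomial

variable {n : ℕ} {ι : Type*} [Fintype ι] [DecidableEq ι]

theorem pow_eq_one_of_charpoly_eq {R : Type*} [CommRing R] {M : Matrix ι ι R}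
    (h : M.charpoly = X ^ n - 1) : M ^ n = 1 := by
  simpa [h, sub_eq_zero] using M.aeval_self_charpoly

section Field
variable {K : Type*} [Field K] {M : Matrix ι ι K}

theorem spectrum_eq_of_charpoly_eq (h : M.charpoly = X ^ n - 1) :
    spectrum K M = {w : K | w ^ n = 1} := by
  ext w
  rw [mem_spectrum_iff_isRoot_charpoly, h]
  simp [sub_eq_zero]

theorem rootMultiplicity_charpoly_eq_one (hn : (n : K) ≠ 0) (h : M.charpoly = X ^ n - 1) {w : K}
    (hw : w ∈ spectrum K M) : M.charpoly.rootMultiplicity w = 1 := by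
  have hnodup : M.charpoly.roots.Nodup := by
    simpa [h] using nodup_roots (separable_X_pow_sub_C (1 : K) hn one_ne_zero)
  classical
  rw [← count_roots]
  exact Multiset.count_eq_one_of_mem hnodup
    ((mem_roots M.charpoly_monic.ne_zero).2 (mem_spectrum_iff_isRoot_charpoly.1 hw))

end Field

theorem expand_two_charpolyRev_sq {R : Type*} [CommRing R] (M : Matrix ι ι R) :
    expand R 2 (M ^ 2).charpolyRev = M.charpolyRev * M.charpolyRev.comp (-X) := by
  have hcomp : ∀ (N : Matrix ι ι R) (q : R[X]),
      N.charpolyRev.comp q = (1 - q • N.map C).det := by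
    intro N q
    rw [charpolyRev, ← coe_compRingHom_apply, RingHom.map_det]
    congr 1
    refine Matrix.ext fun i j => ?_
    by_cases hij : i = j <;> simp [hij, mul_comm q]
  rw [expand_eq_comp_X_pow, hcomp, hcomp, charpolyRev, ← det_mul, sq M, Matrix.map_mul]
  congr 1
  simp only [neg_smul, sub_neg_eq_add, sub_mul, mul_add, one_mul, mul_one, smul_mul_smul_comm, sq]
  abel

theorem trace_sq_eq_zero_of_charpoly_eq {R : Type*} [CommRing R] [Nontrivial R] {M : Matrix ι ι R}
    {s : R} (hn : 2 < n) (h : M.charpoly = X ^ n - C s) : (M ^ 2).trace = 0 := by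
  have hrev : M.charpolyRev = 1 - X ^ n * C s := by
    rw [← reverse_charpoly, h, reverse, natDegree_X_pow_sub_C, reflect_sub, reflect_C]
    simp
  have hexpand : expand R 2 (M ^ 2).charpolyRev
      = 1 - X ^ n * (C s + (-1) ^ n * C s - (-1) ^ n * X ^ n * C s ^ 2) := by
    rw [expand_two_charpolyRev_sq, hrev]
    simp only [sub_comp, one_comp, mul_comp, pow_comp, X_comp, C_comp]
    rw [neg_pow]
    ring
  have hcoeff := congrArg (coeff · (1 * 2)) hexpand
  simp only [coeff_expand_mul two_pos, coeff_charpolyRev_eq_neg_trace] at hcoeff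
  simpa [coeff_X_pow_mul', hn.not_ge, coeff_one] using hcoeff

end Charpoly

section Unitarity

open Matrix Polynomial

theorem norm_map_eq_of_norm_le_one_of_pow_eq_one {𝕜 E : Type*} [NontriviallyNormedField 𝕜]
    [SeminormedAddCommGroup E] [NormedSpace 𝕜 E] {T : E →L[𝕜] E} {n : ℕ} (hn : n ≠ 0)
    (hT : ‖T‖ ≤ 1) (hTn : T ^ n = 1) (v : E) : ‖T v‖ = ‖v‖ := by
  have hle : ∀ w, ‖T w‖ ≤ ‖w‖ := fun w => by
    simpa using T.le_of_opNorm_le hT w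
  have hpow : ∀ (m : ℕ) w, ‖(T ^ m) w‖ ≤ ‖w‖ := by
    intro m
    induction m with
    | zero => simp
    | succ m ih => exact fun w => (ih (T w)).trans (hle w)
  refine (hle v).antisymm ?_
  calc ‖v‖ = ‖(T ^ (n - 1)) (T v)‖ := by
        rw [← mul_apply_eq_comp, ← pow_succ, Nat.sub_one_add_one hn, hTn, one_apply_eq_self]
    _ ≤ ‖T v‖ := hpow _ _

variable {n : ℕ} {ι : Type*} [Fintype ι] [DecidableEq ι]

theorem mem_unitaryGroup_of_opNorm_le_one_of_pow_eq_one {𝕜 : Type*} [RCLike 𝕜]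
    {M : Matrix ι ι 𝕜} (hn : n ≠ 0) (hM : ‖toEuclideanCLM (𝕜 := 𝕜) M‖ ≤ 1)
    (hMn : M ^ n = 1) : M ∈ unitaryGroup ι 𝕜 := by
  have hT : star (toEuclideanCLM (𝕜 := 𝕜) M) * toEuclideanCLM (𝕜 := 𝕜) M = 1 :=
    (ContinuousLinearMap.norm_map_iff_adjoint_comp_self _).1 <|
      norm_map_eq_of_norm_le_one_of_pow_eq_one hn hM (by rw [← map_pow, hMn, map_one])
  rw [mem_unitaryGroup_iff']
  apply EquivLike.injective (toEuclideanCLM (n := ι) (𝕜 := 𝕜))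
  rw [map_mul, map_star, map_one, hT]

open scoped Matrix.Norms.L2Operator in
theorem mem_unitaryGroup_of_isStarNormal_of_pow_eq_one {M : Matrix ι ι ℂ} (hn : n ≠ 0)
    (hM : IsStarNormal M) (hMn : M ^ n = 1) : M ∈ unitaryGroup ι ℂ := by
  refine unitary_iff_isStarNormal_and_spectrum_subset_unitary.2 ⟨hM, fun w hw => ?_⟩
  have hwn : w ^ n = 1 := by
    cases subsingleton_or_nontrivial (Matrix ι ι ℂ)
    · simp at hw
    · simpa [hMn] using spectrum.pow_mem_pow M n hw
  have hnorm : ‖w‖ = 1 := Complex.norm_eq_one_of_pow_eq_one hwn hn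
  simp [Unitary.mem_iff, Complex.conj_mul', Complex.mul_conj', hnorm]

end Unitarity

section Eigenbasis

open Matrix Module

variable {𝕜 E ι : Type*} [RCLike 𝕜] [NormedAddCommGroup E] [InnerProductSpace 𝕜 E]

theorem orthonormal_of_apply_eq_smul {T : E →ₗ[𝕜] E} {e : ι → E} {a : ι → 𝕜}
    (hT : ∀ v w, inner 𝕜 (T v) (T w) = inner 𝕜 v w) (ha : Function.Injective a)
    (ha' : ∀ i, ‖a i‖ = 1) (he : ∀ i, ‖e i‖ = 1) (hTe : ∀ i, T (e i) = a i • e i) :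
    Orthonormal 𝕜 e := by
  refine ⟨he, fun i j hij => ?_⟩
  have hinner : starRingEnd 𝕜 (a i) * a j * inner 𝕜 (e i) (e j) = inner 𝕜 (e i) (e j) := by
    conv_rhs => rw [← hT, hTe, hTe, inner_smul_left, inner_smul_right, ← mul_assoc]
  have hunit : a i * starRingEnd 𝕜 (a i) = 1 := by simp [RCLike.mul_conj, ha']
  by_contra hne
  have hprod : starRingEnd 𝕜 (a i) * a j = 1 :=
    mul_right_cancel₀ hne (hinner.trans (one_mul _).symm)
  exact hij (ha (by linear_combination (-a i) * hprod + a j * hunit))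

theorem conjTranspose_toMatrix_of_orthonormal [Finite ι] {e ζ : Basis ι 𝕜 E}
    (he : Orthonormal 𝕜 e) (hζ : Orthonormal 𝕜 ζ) : (e.toMatrix ζ)ᴴ = ζ.toMatrix e := by
  have := Fintype.ofFinite ι
  ext i j
  have hcoord : ∀ {b : Basis ι 𝕜 E}, Orthonormal 𝕜 b → ∀ (v : E) (k : ι),
      b.repr v k = inner 𝕜 (b k) v := fun {b} hb v k => by
    simpa using (b.toOrthonormalBasis hb).repr_apply_apply v k
  rw [conjTranspose_apply, Basis.toMatrix_apply, Basis.toMatrix_apply, hcoord he, hcoord hζ]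
  exact inner_conj_symm _ _

variable [Fintype ι] [DecidableEq ι]

theorem toMatrix_mem_unitaryGroup_of_orthonormal {e ζ : Basis ι 𝕜 E} (he : Orthonormal 𝕜 e)
    (hζ : Orthonormal 𝕜 ζ) : e.toMatrix ζ ∈ unitaryGroup ι 𝕜 := by
  rw [mem_unitaryGroup_iff, star_eq_conjTranspose, conjTranspose_toMatrix_of_orthonormal he hζ,
    e.toMatrix_mul_toMatrix_flip]

theorem orthonormal_of_mem_unitaryGroup {A : Matrix ι ι 𝕜} (hA : A ∈ unitaryGroup ι 𝕜)
    {e : ι → EuclideanSpace 𝕜 ι} {a : ι → 𝕜} (ha : Function.Injective a) (ha' : ∀ i, ‖a i‖ = 1)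
    (he : ∀ i, ‖e i‖ = 1) (hAe : ∀ i, toEuclideanLin A (e i) = a i • e i) : Orthonormal 𝕜 e :=
  orthonormal_of_apply_eq_smul (T := toEuclideanLin A)
    (ContinuousLinearMap.inner_map_map_of_mem_unitary
      (Unitary.map_mem (toEuclideanCLM (n := ι) (𝕜 := 𝕜)) hA)) ha ha' he hAe

theorem eq_toMatrix_mul_diagonal_mul_toMatrix {A : Matrix ι ι 𝕜}
    {e : Basis ι 𝕜 (EuclideanSpace 𝕜 ι)} {a : ι → 𝕜}
    (hAe : ∀ i, toEuclideanLin A (e i) = a i • e i) :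
    A = (EuclideanSpace.basisFun ι 𝕜).toBasis.toMatrix e * diagonal a *
      e.toMatrix (EuclideanSpace.basisFun ι 𝕜).toBasis := by
  have hdiag : LinearMap.toMatrix e e (toEuclideanLin A) = diagonal a := by
    ext i j
    by_cases hij : i = j <;> simp [LinearMap.toMatrix_apply, hAe, hij]
  rw [← hdiag, basis_toMatrix_mul_linearMap_toMatrix_mul_basis_toMatrix,
    toEuclideanLin_eq_toLin_orthonormal, LinearMap.toMatrix_toLin]

theorem det_sub_of_eigenbases {A B : Matrix ι ι 𝕜} {e ζ : Basis ι 𝕜 (EuclideanSpace 𝕜 ι)}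
    {a b : ι → 𝕜} (hAe : ∀ i, toEuclideanLin A (e i) = a i • e i)
    (hBζ : ∀ i, toEuclideanLin B (ζ i) = b i • ζ i) (x y z : 𝕜) :
    (e.toMatrix ζ - (x • (diagonal a * e.toMatrix ζ) + y • (e.toMatrix ζ * diagonal b) +
      z • (diagonal a * e.toMatrix ζ * diagonal b))).det
      = (e.toMatrix ζ).det * (1 - (x • A + y • B + z • (A * B))).det := by
  set β := (EuclideanSpace.basisFun ι 𝕜).toBasis
  have hA : A = β.toMatrix e * diagonal a * e.toMatrix β :=
    eq_toMatrix_mul_diagonal_mul_toMatrix hAe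
  have hB : B = β.toMatrix ζ * diagonal b * ζ.toMatrix β :=
    eq_toMatrix_mul_diagonal_mul_toMatrix hBζ
  have hX : e.toMatrix ζ = e.toMatrix β * β.toMatrix ζ := (e.toMatrix_mul_toMatrix β ζ).symm
  have hA' : e.toMatrix β * A = diagonal a * e.toMatrix β := by
    rw [hA, ← Matrix.mul_assoc, ← Matrix.mul_assoc, e.toMatrix_mul_toMatrix_flip, Matrix.one_mul]
  have hB' : B * β.toMatrix ζ = β.toMatrix ζ * diagonal b := by
    rw [hB, Matrix.mul_assoc _ _ (β.toMatrix ζ), ζ.toMatrix_mul_toMatrix_flip, Matrix.mul_one]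
  have hfactor : e.toMatrix ζ - (x • (diagonal a * e.toMatrix ζ) + y • (e.toMatrix ζ * diagonal b) +
      z • (diagonal a * e.toMatrix ζ * diagonal b))
      = e.toMatrix β * (1 - (x • A + y • B + z • (A * B))) * β.toMatrix ζ := by
    simp only [hX, Matrix.mul_sub, Matrix.sub_mul, Matrix.mul_add, Matrix.add_mul, Matrix.mul_smul,
      Matrix.smul_mul, Matrix.mul_one, ← Matrix.mul_assoc, hA']
    simp only [Matrix.mul_assoc, hB']
  rw [hfactor, det_mul, det_mul, hX, det_mul]
  ring

theorem exists_unit_eigenvector {A : Matrix ι ι 𝕜} {a : 𝕜} (ha : a ∈ spectrum 𝕜 A) :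
    ∃ v : EuclideanSpace 𝕜 ι, ‖v‖ = 1 ∧ toEuclideanLin A v = a • v := by
  rw [← spectrum_toLpLin 2, ← End.hasEigenvalue_iff_mem_spectrum] at ha
  obtain ⟨v, hv⟩ := ha.exists_hasEigenvector
  refine ⟨((‖v‖⁻¹ : ℝ) : 𝕜) • v, ?_, ?_⟩
  · simp [norm_smul, hv.2]
  · rw [map_smul, hv.apply_eq_smul, smul_comm]

theorem exists_orthonormal_eigenbasis {A : Matrix ι ι 𝕜} (hA : A ∈ unitaryGroup ι 𝕜)
    {a : ι → 𝕜} (ha : Function.Injective a) (ha' : ∀ i, ‖a i‖ = 1)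
    (hspec : ∀ i, a i ∈ spectrum 𝕜 A) :
    ∃ e : Basis ι 𝕜 (EuclideanSpace 𝕜 ι), Orthonormal 𝕜 e ∧
      ∀ i, toEuclideanLin A (e i) = a i • e i := by
  choose e he hAe using fun i => exists_unit_eigenvector (hspec i)
  have horth := orthonormal_of_mem_unitaryGroup hA ha ha' he hAe
  have hspan := horth.linearIndependent.span_eq_top_of_card_eq_finrank' (by simp)
  exact ⟨Basis.mk horth.linearIndependent hspan.ge, by simpa using horth, by simpa using hAe⟩

end Eigenbasis

section Jacobi

open Matrix Polynomial

variable {ι : Type*} [Fintype ι] [DecidableEq ι]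

theorem trace_adjugate_mul_eq_sum_det_updateCol {R : Type*} [CommRing R] (M N : Matrix ι ι R) :
    (M.adjugate * N).trace = ∑ j, (M.updateCol j (N.col j)).det :=
  Finset.sum_congr rfl fun j _ =>
    (congrFun (cramer_eq_adjugate_mulVec M (N.col j)) j).symm

theorem derivative_det {R : Type*} [CommRing R] (M : Matrix ι ι R[X]) :
    derivative M.det = (M.adjugate * M.map derivative).trace := by
  have hcol : ∀ (σ : Equiv.Perm ι) (j : ι),
      ∏ i, M.updateCol j ((M.map derivative).col j) (σ i) i
        = (∏ i ∈ Finset.univ.erase j, M (σ i) i) * derivative (M (σ j) j) := by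
    intro σ j
    rw [← Finset.prod_erase_mul _ _ (Finset.mem_univ j)]
    congr 1
    · exact Finset.prod_congr rfl fun i hi => by simp [(Finset.mem_erase.1 hi).1]
    · simp
  rw [trace_adjugate_mul_eq_sum_det_updateCol]
  simp only [det_apply, hcol, derivative_sum, derivative_smul, derivative_prod_finset,
    Finset.smul_sum]
  exact Finset.sum_comm

theorem hasDerivAt_det_add_smul {𝕜 : Type*} [NontriviallyNormedField 𝕜] (M N : Matrix ι ι 𝕜) :
    HasDerivAt (fun w : 𝕜 => (M + w • N).det) (M.adjugate * N).trace 0 := by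
  set P : Matrix ι ι 𝕜[X] := M.map C + (X : 𝕜[X]) • N.map C
  have heval : ∀ w, (evalRingHom w).mapMatrix P = M + w • N := fun w => by
    ext i j
    simp [P, mul_comm w]
  have hderiv : P.map derivative = N.map C := by
    ext i j : 2
    simp [P]
  have hdet := P.det.hasDerivAt 0
  have htrace : eval 0 (derivative P.det) = (M.adjugate * N).trace := by
    have hadj : P.adjugate.map (eval 0) = M.adjugate := by
      simpa [heval] using (evalRingHom (0 : 𝕜)).map_adjugate P
    have hN : (N.map C).map (eval 0) = N := by
      ext i j
      simp
    calc eval 0 (derivative P.det) = ((P.adjugate * N.map C).map (evalRingHom 0)).trace := by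
          rw [derivative_det, hderiv]
          exact AddMonoidHom.map_trace (evalRingHom (0 : 𝕜)) _
      _ = (M.adjugate * N).trace := by
          rw [Matrix.map_mul, coe_evalRingHom, hadj, hN]
  rw [htrace] at hdet
  refine hdet.congr_of_eventuallyEq (.of_forall fun w => ?_)
  exact (congrArg det (heval w)).symm.trans ((evalRingHom w).map_det P).symm

end Jacobi

section Moduli

open Matrix

variable {n : ℕ}

theorem nodal_unityRoot_eq (hn : n ≠ 0) :
    Lagrange.nodal Finset.univ (fun j : Fin n => unityRoot n j) = Polynomial.X ^ n - 1 := by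
  rw [Lagrange.nodal,
    Fin.prod_univ_eq_prod_range fun j => Polynomial.X - Polynomial.C (unityRoot n j),
    ← Polynomial.C_1, X_pow_sub_C_eq_prod (isPrimitiveRoot_unityRoot hn) (Nat.pos_of_ne_zero hn)
      (one_pow n)]
  exact Finset.prod_congr rfl fun j _ => by rw [unityRoot_eq_pow, mul_one]

theorem prod_erase_one_sub_inv_mul_unityRoot (hn : n ≠ 0) (k : Fin n) :
    ∏ j ∈ Finset.univ.erase k, (1 - (unityRoot n k)⁻¹ * unityRoot n j) = n := by
  have hk := unityRoot_ne_zero n k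
  have hderiv := Lagrange.eval_nodal_derivative_eval_node_eq
    (v := fun j : Fin n => unityRoot n j) (Finset.mem_univ k)
  have hprod : n * unityRoot n k ^ (n - 1)
      = ∏ j ∈ Finset.univ.erase k, (unityRoot n k - unityRoot n j) := by
    simpa [nodal_unityRoot_eq hn, Lagrange.eval_nodal, Polynomial.derivative_X_pow] using hderiv
  have hcard : (Finset.univ.erase k).card = n - 1 := by simp
  calc ∏ j ∈ Finset.univ.erase k, (1 - (unityRoot n k)⁻¹ * unityRoot n j)
      = ∏ j ∈ Finset.univ.erase k, (unityRoot n k)⁻¹ * (unityRoot n k - unityRoot n j) :=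
        Finset.prod_congr rfl fun j _ => by rw [mul_sub, inv_mul_cancel₀ hk]
    _ = (unityRoot n k)⁻¹ ^ (n - 1) * (n * unityRoot n k ^ (n - 1)) := by
        rw [Finset.prod_mul_distrib, Finset.prod_const, hcard, ← hprod]
    _ = n := by rw [mul_left_comm, ← mul_pow, inv_mul_cancel₀ hk, one_pow, mul_one]

theorem adjugate_one_sub_smul_unityDiagonal (hn : n ≠ 0) (k : Fin n) :
    (1 - (unityRoot n k)⁻¹ • unityDiagonal n).adjugate = Matrix.single k k (n : ℂ) := by
  have hdiag : 1 - (unityRoot n k)⁻¹ • unityDiagonal n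
      = diagonal fun j : Fin n => 1 - (unityRoot n k)⁻¹ * unityRoot n j := by
    rw [unityDiagonal, ← diagonal_smul, ← diagonal_one, ← diagonal_sub]
    rfl
  rw [hdiag, adjugate_diagonal, ← diagonal_single]
  congr 1
  ext i
  obtain rfl | hik := eq_or_ne i k
  · rw [prod_erase_one_sub_inv_mul_unityRoot hn, Pi.single_eq_same]
  · rw [Pi.single_eq_of_ne hik]
    exact Finset.prod_eq_zero (Finset.mem_erase.2 ⟨hik.symm, Finset.mem_univ k⟩)
      (by rw [inv_mul_cancel₀ (unityRoot_ne_zero n k), sub_self])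

theorem adjugate_eq_det_smul_conjTranspose {ι : Type*} [Fintype ι] [DecidableEq ι]
    {R : Type*} [CommRing R] [StarRing R] {X : Matrix ι ι R} (hX : X ∈ unitaryGroup ι R) :
    X.adjugate = X.det • Xᴴ := by
  rw [mem_unitaryGroup_iff, star_eq_conjTranspose] at hX
  calc X.adjugate = X.adjugate * (X * Xᴴ) := by rw [hX, Matrix.mul_one]
    _ = X.det • Xᴴ := by rw [← Matrix.mul_assoc, adjugate_mul, Matrix.smul_mul, Matrix.one_mul]

theorem trace_adjugate_mul_eq (hn : n ≠ 0) {X : Matrix (Fin n) (Fin n) ℂ}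
    (hX : X ∈ unitaryGroup (Fin n) ℂ) (k j : Fin n) :
    (((1 - (unityRoot n k)⁻¹ • unityDiagonal n) * X *
        (1 - (unityRoot n j)⁻¹ • unityDiagonal n)).adjugate *
      (unityDiagonal n * X * unityDiagonal n)).trace
      = n ^ 2 * X.det * (unityRoot n k * unityRoot n j * ‖X k j‖ ^ 2) := by
  rw [adjugate_mul_distrib, adjugate_mul_distrib, adjugate_one_sub_smul_unityDiagonal hn,
    adjugate_one_sub_smul_unityDiagonal hn, adjugate_eq_det_smul_conjTranspose hX,
    ← Matrix.mul_assoc (single _ _ _), single_mul_mul_single, trace_single_mul, unityDiagonal,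
    mul_diagonal, diagonal_mul, Matrix.smul_apply, conjTranspose_apply, ← Complex.mul_conj',
    RCLike.star_def]
  simp only [smul_eq_mul]
  ring

theorem inv_unityRoot_pow_sub_one (hn : n ≠ 0) (j : ℕ) :
    (unityRoot n j)⁻¹ ^ (n - 1) = unityRoot n j := by
  rw [inv_pow, inv_eq_of_mul_eq_one_left]
  rw [← pow_succ', Nat.sub_one_add_one hn, unityRoot_pow_eq_one hn]

theorem hasDerivAt_neg_one_pow_mul_neg_sub_pow (n : ℕ) (c : ℂ) :
    HasDerivAt (fun w : ℂ => (-1) ^ (n - 1) * (-c - w) ^ n) (-(n * c ^ (n - 1))) 0 := by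
  have hpow : HasDerivAt (fun w : ℂ => (-c - w) ^ n) (n * (-c - 0) ^ (n - 1) * (-1)) 0 :=
    ((hasDerivAt_id (0 : ℂ)).const_sub _).fun_pow n
  refine (hpow.const_mul _).congr_deriv ?_
  have hsign : ((-1) ^ (n - 1) * (-1) ^ (n - 1) : ℂ) = 1 := by rw [← mul_pow]; simp
  rw [sub_zero, neg_pow c]
  linear_combination -n * c ^ (n - 1) * hsign

/-- At `x = λₖ⁻¹`, `y = λⱼ⁻¹` the adjugates of `1 - x D` and `1 - y D` are multiples of matrix
units, so the `w`-derivative of `det ((1 - x D) X (1 - y D) + w D X D)` isolates the entry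
`X k j`. -/
theorem card_mul_norm_sq_apply_eq_one (hn : n ≠ 0) {X : Matrix (Fin n) (Fin n) ℂ}
    (hX : X ∈ unitaryGroup (Fin n) ℂ)
    (hdet : ∀ x y z : ℂ, (X - (x • (unityDiagonal n * X) + y • (X * unityDiagonal n) +
      z • (unityDiagonal n * X * unityDiagonal n))).det
        = X.det * (1 - (x ^ n + y ^ n + (-1) ^ (n - 1) * z ^ n))) (k j : Fin n) :
    n * ‖X k j‖ ^ 2 = 1 := by
  set D := unityDiagonal n
  set x := (unityRoot n k)⁻¹
  set y := (unityRoot n j)⁻¹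
  have hleft := hasDerivAt_det_add_smul ((1 - x • D) * X * (1 - y • D)) (D * X * D)
  rw [trace_adjugate_mul_eq hn hX] at hleft
  have hright : HasDerivAt (fun w : ℂ => X.det * (1 - (x ^ n + y ^ n +
      (-1) ^ (n - 1) * (-(x * y) - w) ^ n))) (X.det * (n * (x * y) ^ (n - 1))) 0 :=
    ((((hasDerivAt_neg_one_pow_mul_neg_sub_pow n (x * y)).const_add _).const_sub 1).const_mul
      X.det).congr_deriv (by rw [neg_neg])
  have hsame : (fun w : ℂ => ((1 - x • D) * X * (1 - y • D) + w • (D * X * D)).det)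
      = fun w => X.det * (1 - (x ^ n + y ^ n + (-1) ^ (n - 1) * (-(x * y) - w) ^ n)) := by
    ext w
    rw [← hdet]
    congr 1
    simp only [sub_mul, mul_sub, one_mul, mul_one, Matrix.smul_mul, Matrix.mul_smul, smul_smul,
      sub_smul, neg_smul, mul_comm x]
    abel
  rw [hsame] at hleft
  have hX0 : X.det ≠ 0 := (UnitaryGroup.det_isUnit ⟨X, hX⟩).ne_zero
  have hn0 : (n : ℂ) ≠ 0 := Nat.cast_ne_zero.2 hn
  have hxy : (x * y) ^ (n - 1) = unityRoot n k * unityRoot n j := by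
    rw [mul_pow, inv_unityRoot_pow_sub_one hn, inv_unityRoot_pow_sub_one hn]
  have huniq := hleft.unique hright
  rw [hxy] at huniq
  have hkj : unityRoot n k * unityRoot n j ≠ 0 :=
    mul_ne_zero (unityRoot_ne_zero n k) (unityRoot_ne_zero n j)
  have hcancel : X.det * n * (unityRoot n k * unityRoot n j) ≠ 0 :=
    mul_ne_zero (mul_ne_zero hX0 hn0) hkj
  have : (n * ‖X k j‖ ^ 2 : ℂ) = 1 := mul_left_cancel₀ hcancel (by linear_combination huniq)
  exact_mod_cast this

end Moduli

section ComplexHadamard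

open Matrix

variable {n : ℕ} {h h₁ h₂ h₃ : Matrix (Fin n) (Fin n) ℂ}

theorem hadamardSimilar_iff :
    HadamardSimilar h₁ h₂ ↔ ∃ (l₁ l₂ : Fin n → ℂ) (s₁ s₂ : Equiv.Perm (Fin n)),
      (∀ i, ‖l₁ i‖ = 1) ∧ (∀ i, ‖l₂ i‖ = 1) ∧
        ∀ i j, h₂ i j = l₁ i * h₁ (s₁ i) (s₂ j) * l₂ j := by
  have hentry : ∀ (l₁ l₂ : Fin n → ℂ) (s₁ s₂ : Equiv.Perm (Fin n)) i j,
      (diagonal l₁ * s₁.permMatrix ℂ * h₁ * s₂.permMatrix ℂ * diagonal l₂) i j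
        = l₁ i * h₁ (s₁ i) (s₂.symm j) * l₂ j := by
    intro l₁ l₂ s₁ s₂ i j
    rw [mul_diagonal, Equiv.Perm.permMatrix, Equiv.Perm.permMatrix, PEquiv.mul_toMatrix_toPEquiv,
      Matrix.mul_assoc, submatrix_apply, diagonal_mul, PEquiv.toMatrix_toPEquiv_mul,
      submatrix_apply]
    rfl
  constructor
  · rintro ⟨l₁, l₂, s₁, s₂, hl₁, hl₂, rfl⟩
    exact ⟨l₁, l₂, s₁, s₂.symm, hl₁, hl₂, hentry l₁ l₂ s₁ s₂⟩
  · rintro ⟨l₁, l₂, s₁, s₂, hl₁, hl₂, h⟩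
    refine ⟨l₁, l₂, s₁, s₂.symm, hl₁, hl₂, ?_⟩
    ext i j
    rw [hentry, h, Equiv.symm_symm]

theorem HadamardSimilar.trans (h₁₂ : HadamardSimilar h₁ h₂) (h₂₃ : HadamardSimilar h₂ h₃) :
    HadamardSimilar h₁ h₃ := by
  obtain ⟨l₁, l₂, s₁, s₂, hl₁, hl₂, hl⟩ := hadamardSimilar_iff.1 h₁₂
  obtain ⟨m₁, m₂, t₁, t₂, hm₁, hm₂, hm⟩ := hadamardSimilar_iff.1 h₂₃
  refine hadamardSimilar_iff.2 ⟨fun i => m₁ i * l₁ (t₁ i), fun j => l₂ (t₂ j) * m₂ j, s₁ * t₁,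
    s₂ * t₂, fun i => by simp [hl₁, hm₁], fun j => by simp [hl₂, hm₂], fun i j => ?_⟩
  rw [hm, hl, Equiv.Perm.mul_apply, Equiv.Perm.mul_apply]
  ring

theorem hadamardSimilar_submatrix (h : Matrix (Fin n) (Fin n) ℂ) (s t : Equiv.Perm (Fin n)) :
    HadamardSimilar h (h.submatrix s t) :=
  hadamardSimilar_iff.2 ⟨1, 1, s, t, by simp, by simp, by simp⟩

theorem submatrix_hadamardSimilar (h : Matrix (Fin n) (Fin n) ℂ) (s t : Equiv.Perm (Fin n)) :
    HadamardSimilar (h.submatrix s t) h :=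
  hadamardSimilar_iff.2 ⟨1, 1, s.symm, t.symm, by simp, by simp, by simp⟩

namespace IsComplexHadamard

theorem ne_zero (hh : IsComplexHadamard h) (i j : Fin n) : h i j ≠ 0 := by
  rw [← norm_ne_zero_iff, hh.1]
  exact one_ne_zero

theorem sum_mul_inv_eq_zero (hh : IsComplexHadamard h) {i i' : Fin n} (hi : i ≠ i') :
    ∑ j, h i j * (h i' j)⁻¹ = 0 := by
  rw [← hh.2 i i' hi]
  exact Finset.sum_congr rfl fun j _ => by rw [Complex.inv_eq_conj (hh.1 i' j)]

theorem mul_conjTranspose_self (hh : IsComplexHadamard h) : h * hᴴ = (n : ℂ) • 1 := by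
  ext i i'
  rw [mul_apply, Matrix.smul_apply]
  obtain rfl | hi := eq_or_ne i i'
  · simp [Complex.mul_conj', hh.1]
  · rw [one_apply_ne hi, smul_zero, ← hh.2 i i' hi]
    rfl

theorem transpose (hh : IsComplexHadamard h) : IsComplexHadamard hᵀ := by
  refine ⟨fun i j => hh.1 j i, fun i i' hi => ?_⟩
  have hn : (n : ℂ) ≠ 0 := Nat.cast_ne_zero.2 i.pos.ne'
  have hleft : ((n : ℂ)⁻¹ • hᴴ) * h = 1 := by
    rw [mul_eq_one_comm, Matrix.mul_smul, hh.mul_conjTranspose_self, smul_smul,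
      inv_mul_cancel₀ hn, one_smul]
  have hcol := congrFun (congrFun hleft i') i
  rw [Matrix.smul_mul, Matrix.smul_apply, one_apply_ne hi.symm, smul_eq_mul,
    mul_eq_zero_iff_left (inv_ne_zero hn), mul_apply] at hcol
  rw [← hcol]
  exact Finset.sum_congr rfl fun j _ => mul_comm _ _

theorem row_injective (hh : IsComplexHadamard h) : Function.Injective h := by
  intro i i' hrow
  by_contra hi
  have hsum := hh.sum_mul_inv_eq_zero hi
  rw [hrow, Finset.sum_congr rfl fun j _ => mul_inv_cancel₀ (hh.ne_zero i' j)] at hsum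
  simp [i.pos.ne'] at hsum

theorem of_similar (hh : IsComplexHadamard h₁) (hs : HadamardSimilar h₁ h₂) :
    IsComplexHadamard h₂ := by
  obtain ⟨l₁, l₂, s, t, hl₁, hl₂, hentry⟩ := hadamardSimilar_iff.1 hs
  refine ⟨fun i j => by simp [hentry, hl₁, hl₂, hh.1], fun i i' hi => ?_⟩
  have horth := hh.2 (s i) (s i') (s.injective.ne hi)
  rw [← Equiv.sum_comp t] at horth
  rw [← mul_zero (l₁ i * starRingEnd ℂ (l₁ i')), ← horth, Finset.mul_sum]
  refine Finset.sum_congr rfl fun j _ => ?_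
  have hunit : l₂ j * starRingEnd ℂ (l₂ j) = 1 := by simp [Complex.mul_conj', hl₂]
  rw [hentry, hentry, map_mul, map_mul]
  linear_combination (l₁ i * h₁ (s i) (t j) * starRingEnd ℂ (l₁ i') *
    starRingEnd ℂ (h₁ (s i') (t j))) * hunit

theorem submatrix (hh : IsComplexHadamard h) (s t : Equiv.Perm (Fin n)) :
    IsComplexHadamard (h.submatrix s t) :=
  hh.of_similar (hadamardSimilar_submatrix h s t)

theorem sqrt_smul_of_mem_unitaryGroup (hh : h ∈ unitaryGroup (Fin n) ℂ)
    (hentry : ∀ i j, n * ‖h i j‖ ^ 2 = 1) : IsComplexHadamard ((Real.sqrt n : ℂ) • h) := by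
  refine ⟨fun i j => ?_, fun i i' hi => ?_⟩
  · rw [Matrix.smul_apply, norm_smul, Complex.norm_real, Real.norm_of_nonneg (Real.sqrt_nonneg _),
      ← sq_eq_sq₀ (by positivity) zero_le_one, mul_pow, Real.sq_sqrt n.cast_nonneg, hentry, one_pow]
  · have hrow := congrFun (congrFun (mem_unitaryGroup_iff.1 hh) i) i'
    rw [mul_apply, one_apply_ne hi] at hrow
    rw [← mul_eq_zero_of_right ((Real.sqrt n : ℂ) * starRingEnd ℂ (Real.sqrt n)) hrow,
      Finset.mul_sum]
    refine Finset.sum_congr rfl fun j _ => ?_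
    rw [Matrix.smul_apply, Matrix.smul_apply, smul_eq_mul, smul_eq_mul, map_mul, mul_mul_mul_comm]
    rfl

end IsComplexHadamard

/-- The zeroth row and column consist of ones: the normal form of a complex Hadamard matrix
under rescaling of its rows and columns. -/
structure IsDephased [NeZero n] (h : Matrix (Fin n) (Fin n) ℂ) : Prop where
  row_zero : ∀ j, h 0 j = 1
  col_zero : ∀ i, h i 0 = 1

theorem IsDephased.transpose [NeZero n] (hh : IsDephased h) : IsDephased hᵀ :=
  ⟨hh.col_zero, hh.row_zero⟩

theorem IsDephased.submatrix [NeZero n] (hh : IsDephased h) {s t : Equiv.Perm (Fin n)}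
    (hs : s 0 = 0) (ht : t 0 = 0) : IsDephased (h.submatrix s t) :=
  ⟨fun j => by rw [submatrix_apply, hs, hh.row_zero],
    fun i => by rw [submatrix_apply, ht, hh.col_zero]⟩

/-- The dephased matrix obtained from `h` by rescaling its rows and columns. -/
noncomputable def dephasing [NeZero n] (h : Matrix (Fin n) (Fin n) ℂ) : Matrix (Fin n) (Fin n) ℂ :=
  of fun i j => h 0 0 * h i j / (h i 0 * h 0 j)

theorem isDephased_dephasing [NeZero n] (hh : IsComplexHadamard h) : IsDephased (dephasing h) := by
  have hne := hh.ne_zero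
  constructor <;> intro <;> simp only [dephasing, of_apply] <;> field [hne]

theorem isComplexHadamard_dephasing [NeZero n] (hh : IsComplexHadamard h) :
    IsComplexHadamard (dephasing h) :=
  hh.of_similar <| hadamardSimilar_iff.2 ⟨fun i => h 0 0 / h i 0, fun j => (h 0 j)⁻¹, 1, 1,
    by simp [hh.1], by simp [hh.1], fun i j => by
      simp only [dephasing, of_apply, Equiv.Perm.one_apply]
      ring⟩

theorem dephasing_hadamardSimilar [NeZero n] (hh : IsComplexHadamard h) :
    HadamardSimilar (dephasing h) h := by
  have hne := hh.ne_zero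
  refine hadamardSimilar_iff.2 ⟨fun i => h i 0, fun j => h 0 j / h 0 0, 1, 1, by simp [hh.1],
    by simp [hh.1], fun i j => ?_⟩
  simp only [dephasing, of_apply, Equiv.Perm.one_apply]
  field [hne]

namespace IsComplexHadamard

theorem sum_row_eq_zero [NeZero n] (hh : IsComplexHadamard h) (hd : IsDephased h) {i : Fin n}
    (hi : i ≠ 0) : ∑ j, h i j = 0 := by
  simpa [hd.row_zero] using hh.sum_mul_inv_eq_zero hi

theorem sum_inv_row_eq_zero [NeZero n] (hh : IsComplexHadamard h) (hd : IsDephased h) {i : Fin n}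
    (hi : i ≠ 0) : ∑ j, (h i j)⁻¹ = 0 := by
  simpa [hd.row_zero] using hh.sum_mul_inv_eq_zero hi.symm

theorem hadamardSimilar_fourierMatrix (hh : IsComplexHadamard h) {r : Fin n → ℂ}
    (hr : ∀ j, r j ^ n = 1) (hrow : ∀ i, ∃ k : ℕ, ∀ j, h i j = r j ^ k) :
    HadamardSimilar (fourierMatrix n) h := by
  choose k hk using hrow
  choose t ht htr using fun j : Fin n =>
    haveI : NeZero n := j.neZero
    (isPrimitiveRoot_unityRoot j.pos.ne').eq_pow_of_pow_eq_one (hr j)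
  let σ : Fin n → Fin n := fun i => ⟨k i % n, Nat.mod_lt _ i.pos⟩
  let τ : Fin n → Fin n := fun j => ⟨t j, ht j⟩
  have hentry : ∀ i j, h i j = fourierMatrix n (σ i) (τ j) := by
    intro i j
    rw [fourierMatrix, of_apply, unityRoot_eq_pow, mul_comm, pow_mul, htr, hk,
      pow_eq_pow_mod _ (hr j)]
  have hσ : Function.Injective σ := fun i i' hi =>
    hh.row_injective (funext fun j => by rw [hentry, hentry, hi])
  have hτ : Function.Injective τ := fun j j' hj =>
    hh.transpose.row_injective (funext fun i => by
      rw [transpose_apply, transpose_apply, hentry, hentry, hj])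
  exact hadamardSimilar_iff.2 ⟨1, 1, .ofBijective σ (Finite.injective_iff_bijective.1 hσ),
    .ofBijective τ (Finite.injective_iff_bijective.1 hτ), by simp, by simp, by simpa using hentry⟩

end IsComplexHadamard

end ComplexHadamard

section OrderThree

theorem hadamardSimilar_fourierMatrix_three {h : Matrix (Fin 3) (Fin 3) ℂ}
    (hh : IsComplexHadamard h) : HadamardSimilar (fourierMatrix 3) h := by
  refine .trans ?_ (dephasing_hadamardSimilar hh)
  have hg := isComplexHadamard_dephasing hh
  have hd := isDephased_dephasing hh
  set g := dephasing h
  have hrow := hg.sum_row_eq_zero hd (i := 1) (by decide)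
  have hrow_inv := hg.sum_inv_row_eq_zero hd (i := 1) (by decide)
  have hcol₁ := hg.transpose.sum_row_eq_zero hd.transpose (i := 1) (by decide)
  have hcol₂ := hg.transpose.sum_row_eq_zero hd.transpose (i := 2) (by decide)
  have h11 := hg.ne_zero 1 1
  have h12 := hg.ne_zero 1 2
  simp only [Fin.sum_univ_three, Matrix.transpose_apply, hd.row_zero, hd.col_zero, inv_one]
    at hrow hrow_inv hcol₁ hcol₂
  have hprod : g 1 1 * g 1 2 = 1 := by
    field_simp at hrow_inv
    linear_combination hrow_inv - hrow
  have e12 : g 1 2 = g 1 1 ^ 2 := by linear_combination -(g 1 1) * hrow + hrow + hprod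
  have e21 : g 2 1 = g 1 1 ^ 2 := by linear_combination e12 + hcol₁ - hrow
  have e22 : g 2 2 = g 1 1 := by linear_combination hcol₂ - hrow
  have hcube : g 1 1 ^ 3 = 1 := by rw [pow_succ', ← e12, hprod]
  have hpow_four : g 1 1 ^ 4 = g 1 1 := by rw [pow_succ, hcube, one_mul]
  refine hg.hadamardSimilar_fourierMatrix (r := g 1) (fun j => ?_) fun i => ⟨i, fun j => ?_⟩
  · fin_cases j <;> simp [hd.col_zero, e12, hcube, pow_right_comm _ 2 3]
  · fin_cases i <;> fin_cases j <;>
      simp [hd.row_zero, hd.col_zero, e12, e21, e22, ← pow_mul, hpow_four]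

end OrderThree

section OrderFour

open Matrix

theorem trace_diagonal_mul_sq {ι R : Type*} [Fintype ι] [DecidableEq ι] [CommSemiring R]
    (l : ι → R) (M : Matrix ι ι R) :
    ((diagonal l * M) ^ 2).trace = ∑ i, ∑ j, l i * l j * (M i j * M j i) := by
  rw [sq, trace]
  refine Finset.sum_congr rfl fun i _ => ?_
  rw [diag_apply, Matrix.mul_apply]
  exact Finset.sum_congr rfl fun j _ => by rw [diagonal_mul, diagonal_mul, mul_mul_mul_comm]

theorem HadamardSimilar.exists_trace_sq_eq {n : ℕ} {h₁ h₂ : Matrix (Fin n) (Fin n) ℂ}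
    (hs : HadamardSimilar h₁ h₂) : ∃ s t : Equiv.Perm (Fin n), ∀ l m : Fin n → ℂ,
      ((diagonal l * (h₂ᴴ * diagonal m * h₂)) ^ 2).trace
        = ((diagonal (l ∘ t) * (h₁ᴴ * diagonal (m ∘ s) * h₁)) ^ 2).trace := by
  obtain ⟨l₁, l₂, s, t, hl₁, hl₂, hentry⟩ := hadamardSimilar_iff.1 hs
  refine ⟨s.symm, t.symm, fun l m => ?_⟩
  set G := h₁ᴴ * diagonal (m ∘ s.symm) * h₁ with hG
  have hconj : ∀ {z : ℂ}, ‖z‖ = 1 → star z * z = 1 := fun hz => by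
    rw [RCLike.star_def, Complex.conj_mul', hz]
    norm_num
  have hgram : ∀ i j, (h₂ᴴ * diagonal m * h₂) i j = star (l₂ i) * l₂ j * G (t i) (t j) := by
    intro i j
    rw [hG, Matrix.mul_apply, Matrix.mul_apply, Finset.mul_sum]
    refine (Finset.sum_congr rfl fun k _ => ?_).trans (Equiv.sum_comp s _)
    simp only [mul_diagonal, conjTranspose_apply, hentry, star_mul', Function.comp_apply,
      Equiv.symm_apply_apply]
    linear_combination (star (h₁ (s k) (t i)) * star (l₂ i) * m k * h₁ (s k) (t j) * l₂ j) *
      hconj (hl₁ k)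
  rw [trace_diagonal_mul_sq, trace_diagonal_mul_sq]
  refine (Finset.sum_congr rfl fun i _ => ?_).trans (Equiv.sum_comp t _)
  refine (Finset.sum_congr rfl fun j _ => ?_).trans (Equiv.sum_comp t _)
  rw [hgram, hgram, Function.comp_apply, Function.comp_apply, Equiv.symm_apply_apply,
    Equiv.symm_apply_apply]
  linear_combination (l i * l j * G (t i) (t j) * G (t j) (t i)) *
    (star (l₂ j) * l₂ j * hconj (hl₂ i) + hconj (hl₂ j))

/-- The one-parameter family of complex Hadamard matrices of order four, with rows and columns
arranged so that `t = i` gives the Fourier matrix. -/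
def hadamardFamilyFour (t : ℂ) : Matrix (Fin 4) (Fin 4) ℂ :=
  !![1, 1, 1, 1; 1, t, -1, -t; 1, -1, 1, -1; 1, -t, -1, t]

theorem eq_neg_one_or_of_sum_eq_zero {K : Type*} [Field K] {a b c : K} (ha : a ≠ 0) (hb : b ≠ 0)
    (hc : c ≠ 0) (h : 1 + a + b + c = 0) (h' : 1 + a⁻¹ + b⁻¹ + c⁻¹ = 0) :
    a = -1 ∨ b = -1 ∨ c = -1 := by
  field_simp at h'
  have : (a + 1) * ((b + 1) * (c + 1)) = 0 := by linear_combination h + h'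
  simpa [add_eq_zero_iff_eq_neg] using this

theorem eq_neg_one_and_of_add_eq_neg_two {a b : ℂ} (ha : ‖a‖ = 1) (hb : ‖b‖ = 1)
    (h : a + b = -2) : a = -1 ∧ b = -1 := by
  have hre : a.re + b.re = -2 := by simpa using congrArg Complex.re h
  have hare : a.re = -1 := by
    have := neg_le_of_abs_le (Complex.abs_re_le_norm a)
    have := neg_le_of_abs_le (Complex.abs_re_le_norm b)
    linarith
  have haim : a.im = 0 := by
    have hnorm := Complex.sq_norm a
    rw [ha, Complex.normSq_apply, hare] at hnorm
    nlinarith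
  have ha' : a = -1 := Complex.ext (by simp [hare]) (by simp [haim])
  exact ⟨ha', by linear_combination h - ha'⟩

variable {g : Matrix (Fin 4) (Fin 4) ℂ}

theorem exists_row_entry_eq_neg_one (hg : IsComplexHadamard g) (hd : IsDephased g) {i : Fin 4}
    (hi : i ≠ 0) : ∃ j ≠ 0, g i j = -1 := by
  have hrow := hg.sum_row_eq_zero hd hi
  have hrow_inv := hg.sum_inv_row_eq_zero hd hi
  rw [Fin.sum_univ_four, hd.col_zero] at hrow hrow_inv
  rw [inv_one] at hrow_inv
  rcases eq_neg_one_or_of_sum_eq_zero (hg.ne_zero _ _) (hg.ne_zero _ _) (hg.ne_zero _ _) hrow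
    hrow_inv with h | h | h
  exacts [⟨1, by decide, h⟩, ⟨2, by decide, h⟩, ⟨3, by decide, h⟩]

theorem entry_eq_one_or_of_diag_eq_neg_one (hg : IsComplexHadamard g) (hd : IsDephased g)
    (h11 : g 1 1 = -1) (h22 : g 2 2 = -1) : g 1 2 = 1 ∨ g 2 1 = 1 := by
  have hrow₁ := hg.sum_row_eq_zero hd (i := 1) (by decide)
  have hrow₂ := hg.sum_row_eq_zero hd (i := 2) (by decide)
  have horth := hg.sum_mul_inv_eq_zero (i := 1) (i' := 2) (by decide)
  rw [Fin.sum_univ_four, hd.col_zero] at hrow₁ hrow₂ horth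
  rw [hd.col_zero] at horth
  have h13 : g 1 3 = -g 1 2 := by linear_combination hrow₁ - h11
  have h23 : g 2 3 = -g 2 1 := by linear_combination hrow₂ - h22
  rw [h11, h22, h13, h23, inv_neg, inv_neg, inv_one] at horth
  have hfactor : (1 - g 1 2) * (1 - (g 2 1)⁻¹) = 0 := by linear_combination horth
  rcases mul_eq_zero.1 hfactor with h | h
  · exact .inl (sub_eq_zero.1 h).symm
  · exact .inr (inv_eq_one.1 (sub_eq_zero.1 h).symm)

theorem exists_core_entry_eq_one (hg : IsComplexHadamard g) (hd : IsDephased g) :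
    ∃ i ≠ 0, ∃ j ≠ 0, g i j = 1 := by
  obtain ⟨j, hj, h1j⟩ := exists_row_entry_eq_neg_one hg hd (i := 1) (by decide)
  obtain ⟨k, hk, h2k⟩ := exists_row_entry_eq_neg_one hg hd (i := 2) (by decide)
  obtain rfl | hjk := eq_or_ne j k
  · have hcol := hg.transpose.sum_row_eq_zero hd.transpose hj
    simp only [Fin.sum_univ_four, transpose_apply, hd.row_zero, h1j, h2k] at hcol
    exact ⟨3, by decide, j, hj, by linear_combination hcol⟩
  · obtain ⟨t, ht0, rfl, rfl⟩ : ∃ t : Equiv.Perm (Fin 4), t 0 = 0 ∧ t 1 = j ∧ t 2 = k := by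
      clear h1j h2k
      decide +revert
    rcases entry_eq_one_or_of_diag_eq_neg_one (hg.submatrix 1 t) (hd.submatrix rfl ht0) h1j h2k
      with h | h
    exacts [⟨1, by decide, t 2, hk, h⟩, ⟨2, by decide, t 1, hj, h⟩]

theorem eq_hadamardFamilyFour_of_core (hg : IsComplexHadamard g) (hd : IsDephased g)
    (h22 : g 2 2 = 1) : g = hadamardFamilyFour (g 1 1) := by
  have hrow : ∀ {i}, i ≠ 0 → 1 + g i 1 + g i 2 + g i 3 = 0 := fun hi => by
    simpa [Fin.sum_univ_four, hd.col_zero] using hg.sum_row_eq_zero hd hi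
  have hcol : ∀ {j}, j ≠ 0 → 1 + g 1 j + g 2 j + g 3 j = 0 := fun hj => by
    simpa [Fin.sum_univ_four, hd.row_zero] using
      hg.transpose.sum_row_eq_zero hd.transpose hj
  obtain ⟨h21, h23⟩ := eq_neg_one_and_of_add_eq_neg_two (hg.1 2 1) (hg.1 2 3)
    (by linear_combination hrow (i := 2) (by decide) - h22)
  obtain ⟨h12, h32⟩ := eq_neg_one_and_of_add_eq_neg_two (hg.1 1 2) (hg.1 3 2)
    (by linear_combination hcol (j := 2) (by decide) - h22)
  have h13 : g 1 3 = -g 1 1 := by linear_combination hrow (i := 1) (by decide) - h12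
  have h31 : g 3 1 = -g 1 1 := by linear_combination hcol (j := 1) (by decide) - h21
  have h33 : g 3 3 = g 1 1 := by linear_combination hrow (i := 3) (by decide) - h31 - h32
  ext i j
  fin_cases i <;> fin_cases j <;> simp [hadamardFamilyFour, hd.row_zero, hd.col_zero, *]

theorem exists_hadamardFamilyFour_similar {h : Matrix (Fin 4) (Fin 4) ℂ}
    (hh : IsComplexHadamard h) : ∃ t : ℂ, ‖t‖ = 1 ∧ IsComplexHadamard (hadamardFamilyFour t) ∧
      HadamardSimilar (hadamardFamilyFour t) h := by
  have hd := isDephased_dephasing hh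
  obtain ⟨i, hi, j, hj, hij⟩ := exists_core_entry_eq_one (isComplexHadamard_dephasing hh) hd
  have hg' := (isComplexHadamard_dephasing hh).submatrix (Equiv.swap i 2) (Equiv.swap j 2)
  have heq := eq_hadamardFamilyFour_of_core hg'
    (hd.submatrix (Equiv.swap_apply_of_ne_of_ne hi.symm (by decide))
      (Equiv.swap_apply_of_ne_of_ne hj.symm (by decide))) (by simpa using hij)
  exact ⟨_, hg'.1 1 1, heq ▸ hg', heq ▸ (submatrix_hadamardSimilar _ _ _).trans
    (dephasing_hadamardSimilar hh)⟩

theorem trace_sq_hadamardFamilyFour {t : ℂ} (ht : ‖t‖ = 1) (l m : Fin 4 → ℂ) :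
    ((diagonal l * ((hadamardFamilyFour t)ᴴ * diagonal m * hadamardFamilyFour t)) ^ 2).trace
      = (∑ i, m i) ^ 2 * ∑ i, l i ^ 2 +
        2 * ((l 0 * l 2 + l 1 * l 3) * (m 0 + m 2 - m 1 - m 3) ^ 2 +
          (l 0 + l 2) * (l 1 + l 3) * ((m 0 - m 2) ^ 2 + (m 1 - m 3) ^ 2) +
          (l 0 - l 2) * (l 1 - l 3) * ((m 0 - m 2) * (m 1 - m 3)) * (t + t⁻¹)) := by
  have ht0 : t ≠ 0 := by rw [← norm_ne_zero_iff, ht]; exact one_ne_zero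
  have hgram : (hadamardFamilyFour t)ᴴ * diagonal m * hadamardFamilyFour t
      = let s := m 0 + m 2 - m 1 - m 3
        let p := fun u => m 0 - m 2 + u * (m 1 - m 3)
        !![∑ i, m i, p t, s, p (-t); p t⁻¹, ∑ i, m i, p (-t⁻¹), s;
          s, p (-t), ∑ i, m i, p t; p (-t⁻¹), s, p t⁻¹, ∑ i, m i] := by
    ext i j
    fin_cases i <;> fin_cases j <;>
      simp [hadamardFamilyFour, Matrix.mul_apply, Fin.sum_univ_four, ← Complex.inv_eq_conj ht] <;>
      field_simp <;> ring
  rw [trace_diagonal_mul_sq, hgram]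
  simp [Fin.sum_univ_four]
  field_simp
  ring

theorem six_mul_add_sq_mul_add_sq_eq {t : ℂ} (ht : ‖t‖ = 1) {l m : Fin 4 → ℂ}
    (hl : ∑ i, l i = 0) (hl₂ : ∑ i, l i ^ 2 = 0) (hm : ∑ i, m i = 0) (hm₂ : ∑ i, m i ^ 2 = 0)
    (htr : ((diagonal l * ((hadamardFamilyFour t)ᴴ * diagonal m *
      hadamardFamilyFour t)) ^ 2).trace = 0) :
    6 * (l 0 + l 2) ^ 2 * (m 0 + m 2) ^ 2
      = -((l 0 - l 2) * (l 1 - l 3) * ((m 0 - m 2) * (m 1 - m 3)) * (t + t⁻¹)) := by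
  rw [trace_sq_hadamardFamilyFour ht, hm, hl₂] at htr
  rw [Fin.sum_univ_four] at hl hl₂ hm hm₂
  have hl13 : l 1 + l 3 = -(l 0 + l 2) := by linear_combination hl
  have hm13 : m 1 + m 3 = -(m 0 + m 2) := by linear_combination hm
  have hl02 : l 0 * l 2 + l 1 * l 3 = (l 0 + l 2) ^ 2 := by
    linear_combination (l 1 + l 3 - (l 0 + l 2)) / 2 * hl13 - hl₂ / 2
  have hs : m 0 + m 2 - m 1 - m 3 = 2 * (m 0 + m 2) := by linear_combination -hm13
  have hd : (m 0 - m 2) ^ 2 + (m 1 - m 3) ^ 2 = -2 * (m 0 + m 2) ^ 2 := by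
    linear_combination 2 * hm₂ - (m 1 + m 3 - (m 0 + m 2)) * hm13
  rw [hl02, hs, hl13, hd] at htr
  linear_combination htr / 2

theorem norm_add_sq_eq_two_of_pow_four_eq_one {a b : ℂ} (ha : a ^ 4 = 1) (hb : b ^ 4 = 1)
    (hab : a ≠ b) (hab' : a + b ≠ 0) : ‖a + b‖ ^ 2 = 2 := by
  have hfactor : (a - b) * (a + b) * (a ^ 2 + b ^ 2) = 0 := by linear_combination ha - hb
  have hsq : a ^ 2 + b ^ 2 = 0 :=
    (mul_eq_zero.1 hfactor).resolve_left (mul_ne_zero (sub_ne_zero.2 hab) hab')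
  rw [← norm_pow, show (a + b) ^ 2 = 2 * (a * b) by linear_combination hsq, norm_mul, norm_mul,
    Complex.norm_eq_one_of_pow_eq_one ha four_ne_zero,
    Complex.norm_eq_one_of_pow_eq_one hb four_ne_zero]
  simp

theorem norm_sub_sq_eq_two_of_pow_four_eq_one {a b : ℂ} (ha : a ^ 4 = 1) (hb : b ^ 4 = 1)
    (hab : a ≠ b) (hab' : a + b ≠ 0) : ‖a - b‖ ^ 2 = 2 := by
  rw [sub_eq_add_neg]
  exact norm_add_sq_eq_two_of_pow_four_eq_one ha (by rwa [Even.neg_pow (by decide)])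
    (fun h => hab' (by rw [h, neg_add_cancel])) (by rwa [← sub_eq_add_neg, sub_ne_zero])

theorem norm_sq_of_perm_unityRoot_four (w : Equiv.Perm (Fin 4))
    (h : unityRoot 4 (w 0) + unityRoot 4 (w 2) ≠ 0) :
    ‖unityRoot 4 (w 0) + unityRoot 4 (w 2)‖ ^ 2 = 2 ∧
      ‖unityRoot 4 (w 0) - unityRoot 4 (w 2)‖ ^ 2 = 2 ∧
      ‖unityRoot 4 (w 1) - unityRoot 4 (w 3)‖ ^ 2 = 2 := by
  have hpow : ∀ k, unityRoot 4 k ^ 4 = 1 := unityRoot_pow_eq_one four_ne_zero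
  have hne : ∀ {i j}, i ≠ j → unityRoot 4 (w i) ≠ unityRoot 4 (w j) := fun hij =>
    (unityRoot_injective 4).ne (w.injective.ne hij)
  have hsum : ∑ i, unityRoot 4 (w i) = 0 := by
    simpa using (Equiv.sum_comp w fun i : Fin 4 => unityRoot 4 i ^ 1).trans
      (sum_unityRoot_pow (by decide))
  rw [Fin.sum_univ_four] at hsum
  refine ⟨norm_add_sq_eq_two_of_pow_four_eq_one (hpow _) (hpow _) (hne (by decide)) h,
    norm_sub_sq_eq_two_of_pow_four_eq_one (hpow _) (hpow _) (hne (by decide)) h,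
    norm_sub_sq_eq_two_of_pow_four_eq_one (hpow _) (hpow _) (hne (by decide)) fun h' => h ?_⟩
  linear_combination hsum - h'

theorem sq_eq_neg_one_of_trace_sq_hadamardFamilyFour {t : ℂ} (ht : ‖t‖ = 1)
    (u v : Equiv.Perm (Fin 4)) (htr : ((diagonal (fun i => unityRoot 4 (u i)) *
      ((hadamardFamilyFour t)ᴴ * diagonal (fun i => unityRoot 4 (v i)) *
        hadamardFamilyFour t)) ^ 2).trace = 0) : t ^ 2 = -1 := by
  have ht0 : t ≠ 0 := by rw [← norm_ne_zero_iff, ht]; exact one_ne_zero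
  have hsum : ∀ {k}, ¬ 4 ∣ k → ∀ w : Equiv.Perm (Fin 4), ∑ i, unityRoot 4 (w i) ^ k = 0 :=
    fun hk w => (Equiv.sum_comp w fun i : Fin 4 => unityRoot 4 i ^ _).trans (sum_unityRoot_pow hk)
  have hkey := six_mul_add_sq_mul_add_sq_eq ht (by simpa using hsum (k := 1) (by decide) u)
    (hsum (k := 2) (by decide) u) (by simpa using hsum (k := 1) (by decide) v)
    (hsum (k := 2) (by decide) v) htr
  have hsub : ∀ (w : Equiv.Perm (Fin 4)) {i j}, i ≠ j →
      unityRoot 4 (w i) - unityRoot 4 (w j) ≠ 0 := fun w _ _ hij =>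
    sub_ne_zero.2 ((unityRoot_injective 4).ne (w.injective.ne hij))
  suffices t + t⁻¹ = 0 by
    field_simp at this
    linear_combination this
  by_cases hpq : (unityRoot 4 (u 0) + unityRoot 4 (u 2)) *
      (unityRoot 4 (v 0) + unityRoot 4 (v 2)) = 0
  · rw [mul_assoc, ← mul_pow, hpq, zero_pow two_ne_zero, mul_zero, zero_eq_neg] at hkey
    exact (mul_eq_zero.1 hkey).resolve_left (mul_ne_zero
      (mul_ne_zero (hsub u (by decide)) (hsub u (by decide)))
      (mul_ne_zero (hsub v (by decide)) (hsub v (by decide))))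
  · exfalso
    obtain ⟨hu, hv⟩ := mul_ne_zero_iff.1 hpq
    obtain ⟨hu₀₂, hu₀₂', hu₁₃'⟩ := norm_sq_of_perm_unityRoot_four u hu
    obtain ⟨hv₀₂, hv₀₂', hv₁₃'⟩ := norm_sq_of_perm_unityRoot_four v hv
    have hbound : ‖t + t⁻¹‖ ≤ 2 := (norm_add_le _ _).trans (by rw [norm_inv, ht]; norm_num)
    have hnorm := congrArg (‖·‖ ^ 2) hkey
    simp only [norm_mul, norm_neg, norm_pow, mul_pow, hu₀₂, hv₀₂, hu₀₂', hu₁₃', hv₀₂', hv₁₃']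
      at hnorm
    norm_num at hnorm
    nlinarith [norm_nonneg (t + t⁻¹)]

theorem hadamardSimilar_fourierMatrix_four {h : Matrix (Fin 4) (Fin 4) ℂ}
    (hh : IsComplexHadamard h) (htr : ((unityDiagonal 4 * hadamardPartner h) ^ 2).trace = 0) :
    HadamardSimilar (fourierMatrix 4) h := by
  obtain ⟨t, ht, hF, hFh⟩ := exists_hadamardFamilyFour_similar hh
  obtain ⟨v, u, htrace⟩ := hFh.exists_trace_sq_eq
  rw [hadamardPartner, Matrix.mul_smul, smul_pow, trace_smul, smul_eq_zero_iff_right (by norm_num),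
    unityDiagonal, htrace] at htr
  have ht₂ := sq_eq_neg_one_of_trace_sq_hadamardFamilyFour ht u v htr
  have ht₃ : t ^ 3 = -t := by rw [pow_succ, ht₂, neg_one_mul]
  have ht₄ : t ^ 4 = 1 := by rw [pow_mul t 2 2, ht₂, neg_one_sq]
  have hneg : (-t) ^ 2 = -1 ∧ (-t) ^ 3 = t ∧ (-t) ^ 4 = 1 := by
    refine ⟨by rw [neg_sq, ht₂], ?_, by rw [Even.neg_pow (by decide), ht₄]⟩
    rw [Odd.neg_pow (by decide), ht₃, neg_neg]
  have hneg_one : (-1 : ℂ) ^ 3 = -1 ∧ (-1 : ℂ) ^ 4 = 1 := by norm_num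
  refine .trans (hF.hadamardSimilar_fourierMatrix (r := hadamardFamilyFour t 1)
    (fun j => ?_) fun i => ⟨i, fun j => ?_⟩) hFh
  · fin_cases j <;> simp [hadamardFamilyFour, ht₄, hneg, hneg_one]
  · fin_cases i <;> fin_cases j <;> simp [hadamardFamilyFour, ht₂, ht₃, hneg, hneg_one]

end OrderFour

section OrderFive

open Matrix

/-- The product of the entries along the `k`-th even generalized diagonal of a matrix of order
three: one of the three positive terms of the determinant. -/
def evenProduct {R : Type*} [CommMonoid R] (m : Matrix (Fin 3) (Fin 3) R) (k : Fin 3) : R :=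
  ∏ i, m i (i + k)

/-- The product of the entries along the `k`-th odd generalized diagonal of a matrix of order
three: one of the three negative terms of the determinant. -/
def oddProduct {R : Type*} [CommMonoid R] (m : Matrix (Fin 3) (Fin 3) R) (k : Fin 3) : R :=
  ∏ i, m i (k - i)

section GeneralizedDiagonals

variable {R : Type*} [CommMonoid R] (m : Matrix (Fin 3) (Fin 3) R)

theorem evenProduct_submatrix_add (a b k : Fin 3) :
    evenProduct (m.submatrix (· + a) (· + b)) k = evenProduct m (k + b - a) := by
  refine (Finset.prod_congr rfl fun i _ => ?_).trans (Equiv.prod_comp (Equiv.addRight a) _)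
  rw [submatrix_apply, Equiv.coe_addRight, add_assoc, add_add_sub_cancel]

theorem oddProduct_submatrix_add (a b k : Fin 3) :
    oddProduct (m.submatrix (· + a) (· + b)) k = oddProduct m (k + b + a) := by
  refine (Finset.prod_congr rfl fun i _ => ?_).trans (Equiv.prod_comp (Equiv.addRight a) _)
  rw [submatrix_apply, Equiv.coe_addRight, add_sub_add_right_eq_sub, sub_add_eq_add_sub]

theorem evenProduct_submatrix_neg (k : Fin 3) :
    evenProduct (m.submatrix id Neg.neg) k = oddProduct m (-k) :=
  Finset.prod_congr rfl fun i _ => by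
    rw [submatrix_apply, id, neg_add_rev, sub_eq_add_neg]

end GeneralizedDiagonals

/-- The upper left block of order three of a matrix of order five. -/
def corner (h : Matrix (Fin 5) (Fin 5) ℂ) : Matrix (Fin 3) (Fin 3) ℂ :=
  h.submatrix (Fin.castLEEmb (by decide)) (Fin.castLEEmb (by decide))

/-- A permutation of the first three indices, extended to all five. -/
def extendPerm (s : Equiv.Perm (Fin 3)) : Equiv.Perm (Fin 5) :=
  s.viaFintypeEmbedding (Fin.castLEEmb (by decide))

theorem corner_submatrix_extendPerm (h : Matrix (Fin 5) (Fin 5) ℂ) (s t : Equiv.Perm (Fin 3)) :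
    corner (h.submatrix (extendPerm s) (extendPerm t)) = (corner h).submatrix s t := by
  ext i j
  simp only [corner, extendPerm, submatrix_apply, Equiv.Perm.viaFintypeEmbedding_apply_image]

variable {g h : Matrix (Fin 5) (Fin 5) ℂ}

-- By orthogonality each factor is minus a sum over the two columns outside the corner, and
-- `(u + v) * (w⁻¹ + z⁻¹) * (w * u⁻¹ + z * v⁻¹)` is invariant under inversion of all four entries.
theorem corner_sums_mul_eq_inv (hg : IsComplexHadamard g) (hd : IsDephased g) :
    (1 + g 1 1 + g 1 2) * (1 + (g 2 1)⁻¹ + (g 2 2)⁻¹) *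
        (1 + g 2 1 * (g 1 1)⁻¹ + g 2 2 * (g 1 2)⁻¹)
      = (1 + (g 1 1)⁻¹ + (g 1 2)⁻¹) * (1 + g 2 1 + g 2 2) *
        (1 + g 1 1 * (g 2 1)⁻¹ + g 1 2 * (g 2 2)⁻¹) := by
  have hrow : ∀ i i' : Fin 5, i ≠ i' → 1 + g i 1 * (g i' 1)⁻¹ + g i 2 * (g i' 2)⁻¹
      = -(g i 3 * (g i' 3)⁻¹ + g i 4 * (g i' 4)⁻¹) := fun i i' hi => by
    have := hg.sum_mul_inv_eq_zero hi
    rw [Fin.sum_univ_five, hd.col_zero, hd.col_zero, inv_one, mul_one] at this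
    linear_combination this
  have h10 := hrow 1 0 (by decide)
  have h01 := hrow 0 1 (by decide)
  have h20 := hrow 2 0 (by decide)
  have h02 := hrow 0 2 (by decide)
  simp only [hd.row_zero, inv_one, mul_one, one_mul] at h10 h01 h20 h02
  rw [h10, h02, hrow 2 1 (by decide), h01, h20, hrow 1 2 (by decide)]
  have hne := hg.ne_zero
  field [hne]

theorem corner_products_coincide (hg : IsComplexHadamard g) (hd : IsDephased g) :
    g 1 1 * g 2 2 = g 1 2 ∨ g 1 2 = g 2 1 ∨ g 2 1 = g 1 1 * g 2 2 := by
  have hrow := corner_sums_mul_eq_inv hg hd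
  have hcol := corner_sums_mul_eq_inv hg.transpose hd.transpose
  simp only [transpose_apply] at hcol
  have hvandermonde :
      (g 1 1 * g 2 2 - g 1 2) * ((g 1 2 - g 2 1) * (g 2 1 - g 1 1 * g 2 2)) = 0 := by
    have := hg.ne_zero 1 1
    have := hg.ne_zero 1 2
    have := hg.ne_zero 2 1
    have := hg.ne_zero 2 2
    field_simp at hrow hcol
    linear_combination (hrow - hcol) / 2
  simpa [sub_eq_zero] using hvandermonde

theorem exists_evenProduct_corner_eq (hg : IsComplexHadamard g) (hd : IsDephased g) :
    ∃ k, evenProduct (corner g) (k + 1) = evenProduct (corner g) (k + 2) := by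
  have hprod : evenProduct (corner g) 0 = g 1 1 * g 2 2 ∧ evenProduct (corner g) 1 = g 1 2 ∧
      evenProduct (corner g) 2 = g 2 1 := by
    simp [evenProduct, corner, Fin.prod_univ_three, hd.row_zero, hd.col_zero]
  obtain ⟨h0, h1, h2⟩ := hprod
  rcases corner_products_coincide hg hd with h | h | h
  exacts [⟨2, h0.trans (h.trans h1.symm)⟩, ⟨0, h1.trans (h.trans h2.symm)⟩,
    ⟨1, h2.trans (h.trans h0.symm)⟩]

theorem exists_oddProduct_corner_eq (hg : IsComplexHadamard g) (hd : IsDephased g) :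
    ∃ k, oddProduct (corner g) (k + 1) = oddProduct (corner g) (k + 2) := by
  have hzero : ∀ s : Equiv.Perm (Fin 3), s 0 = 0 → extendPerm s 0 = 0 := fun s hs =>
    (s.viaFintypeEmbedding_apply_image (Fin.castLEEmb (by decide : 3 ≤ 5)) 0).trans
      (congrArg (Fin.castLE (by decide)) hs)
  obtain ⟨k, hk⟩ := exists_evenProduct_corner_eq
    (hg.submatrix (extendPerm 1) (extendPerm (Equiv.neg (Fin 3))))
    (hd.submatrix (hzero _ rfl) (hzero _ rfl))
  rw [corner_submatrix_extendPerm] at hk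
  refine ⟨-k, ?_⟩
  have hneg : ∀ k : Fin 3, -k + 1 = -(k + 2) ∧ -k + 2 = -(k + 1) := by decide
  rw [(hneg k).1, (hneg k).2]
  exact ((evenProduct_submatrix_neg _ _).symm.trans hk.symm).trans (evenProduct_submatrix_neg _ _)

theorem exists_evenProduct_eq_and_oddProduct_eq (hg : IsComplexHadamard g) (hd : IsDephased g) :
    ∃ s t : Equiv.Perm (Fin 5),
      evenProduct (corner (g.submatrix s t)) 1 = evenProduct (corner (g.submatrix s t)) 2 ∧
      oddProduct (corner (g.submatrix s t)) 1 = oddProduct (corner (g.submatrix s t)) 2 := by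
  obtain ⟨c, hc⟩ := exists_evenProduct_corner_eq hg hd
  obtain ⟨d, hd⟩ := exists_oddProduct_corner_eq hg hd
  -- Shifting rows by `a` and columns by `b` moves the index of an even generalized diagonal by
  -- `b - a` and that of an odd one by `b + a`; modulo three these can be prescribed independently.
  refine ⟨extendPerm (Equiv.addRight (c - d)), extendPerm (Equiv.addRight (-c - d)), ?_⟩
  rw [corner_submatrix_extendPerm, Equiv.coe_addRight, Equiv.coe_addRight]
  rw [evenProduct_submatrix_add, evenProduct_submatrix_add, oddProduct_submatrix_add,
    oddProduct_submatrix_add]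
  have he : ∀ k, k + (-c - d) - (c - d) = c + k := by clear hc hd; decide +revert
  have ho : ∀ k, k + (-c - d) + (c - d) = d + k := by clear hc hd; decide +revert
  rw [he, he, ho, ho]
  exact ⟨hc, hd⟩

/-- A dephased matrix of order five whose upper left block of order three is
`!![1, 1, 1; 1, a, b; 1, b, a]`, the normal form to which every complex Hadamard matrix of order
five can be brought. -/
structure HasSymmetricCorner (g : Matrix (Fin 5) (Fin 5) ℂ) : Prop extends IsDephased g where
  apply_one_two : g 1 2 = g 2 1
  apply_one_one : g 1 1 = g 2 2

theorem exists_hasSymmetricCorner_similar (hh : IsComplexHadamard h) :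
    ∃ g, IsComplexHadamard g ∧ HasSymmetricCorner g ∧ HadamardSimilar g h := by
  obtain ⟨s, t, he, ho⟩ := exists_evenProduct_eq_and_oddProduct_eq
    (isComplexHadamard_dephasing hh) (isDephased_dephasing hh)
  have hg := (isComplexHadamard_dephasing hh).submatrix s t
  set m := (dephasing h).submatrix s t
  have he : m 0 1 * m 1 2 * m 2 0 = m 0 2 * m 1 0 * m 2 1 := by
    simpa [evenProduct, corner, Fin.prod_univ_three] using he
  have ho : m 0 1 * m 1 0 * m 2 2 = m 0 2 * m 1 1 * m 2 0 := by
    simpa [oddProduct, corner, Fin.prod_univ_three] using ho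
  have hne := hg.ne_zero
  refine ⟨_, isComplexHadamard_dephasing hg, ⟨isDephased_dephasing hg, ?_, ?_⟩,
    (dephasing_hadamardSimilar hg).trans ((submatrix_hadamardSimilar _ s t).trans
      (dephasing_hadamardSimilar hh))⟩ <;>
  rw [dephasing, of_apply, of_apply,
    div_eq_div_iff (mul_ne_zero (hne _ _) (hne _ _)) (mul_ne_zero (hne _ _) (hne _ _))]
  · linear_combination m 0 0 * he
  · linear_combination -m 0 0 * ho

/-- The relations between the entries of two orthogonal unimodular rows `(1, a, b, v, w)` and
`(1, b, a, w, v)`, each of which is orthogonal to the constant row. -/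
structure ReflectedRows (a b v w : ℂ) : Prop where
  norm_a : ‖a‖ = 1
  norm_b : ‖b‖ = 1
  norm_v : ‖v‖ = 1
  norm_w : ‖w‖ = 1
  sum : 1 + a + b + v + w = 0
  sum_inv : 1 + a⁻¹ + b⁻¹ + v⁻¹ + w⁻¹ = 0
  sum_mul_inv : 1 + a * b⁻¹ + b * a⁻¹ + v * w⁻¹ + w * v⁻¹ = 0

theorem add_inv_ne_neg_three {z : ℂ} (hz : ‖z‖ = 1) : z + z⁻¹ ≠ -3 := by
  intro h
  have hbound := norm_add_le z z⁻¹
  rw [h, norm_inv, hz] at hbound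
  norm_num at hbound

theorem pair_eq_of_add_eq {K : Type*} [Field K] {x y a b : K} (hx : x ≠ 0) (hy : y ≠ 0)
    (ha : a ≠ 0) (hb : b ≠ 0) (h : x + y = a + b) (h' : x⁻¹ + y⁻¹ = a⁻¹ + b⁻¹) (hab : a + b ≠ 0) :
    x = a ∧ y = b ∨ x = b ∧ y = a := by
  have hmul : x * y = a * b := by
    field_simp at h'
    refine mul_left_cancel₀ hab ?_
    linear_combination -h' + a * b * h
  have hroot : (x - a) * (x - b) = 0 := by linear_combination x * h - hmul
  rcases mul_eq_zero.1 hroot with hxa | hxb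
  · exact .inl ⟨sub_eq_zero.1 hxa, by linear_combination h - hxa⟩
  · exact .inr ⟨sub_eq_zero.1 hxb, by linear_combination h - hxb⟩

namespace ReflectedRows

variable {a b v w : ℂ}

theorem swap_halves (h : ReflectedRows a b v w) : ReflectedRows v w a b where
  norm_a := h.norm_v
  norm_b := h.norm_w
  norm_v := h.norm_a
  norm_w := h.norm_b
  sum := by linear_combination h.sum
  sum_inv := by linear_combination h.sum_inv
  sum_mul_inv := by linear_combination h.sum_mul_inv

theorem swap_left (h : ReflectedRows a b v w) : ReflectedRows b a v w where
  norm_a := h.norm_b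
  norm_b := h.norm_a
  norm_v := h.norm_v
  norm_w := h.norm_w
  sum := by linear_combination h.sum
  sum_inv := by linear_combination h.sum_inv
  sum_mul_inv := by linear_combination h.sum_mul_inv

theorem swap_right (h : ReflectedRows a b v w) : ReflectedRows a b w v :=
  h.swap_halves.swap_left.swap_halves

theorem ne_zero (h : ReflectedRows a b v w) : a ≠ 0 := by
  rw [← norm_ne_zero_iff, h.norm_a]
  exact one_ne_zero

theorem left_ne (h : ReflectedRows a b v w) : a ≠ b := by
  rintro rfl
  refine add_inv_ne_neg_three (z := v * w⁻¹) (by simp [h.norm_v, h.norm_w]) ?_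
  rw [mul_inv, inv_inv]
  linear_combination h.sum_mul_inv - 2 * mul_inv_cancel₀ h.ne_zero

theorem left_add_ne_zero (h : ReflectedRows a b v w) : a + b ≠ 0 := by
  intro hab
  obtain rfl : b = -a := by linear_combination hab
  have hsum_inv := h.sum_inv
  have hsum_mul_inv := h.sum_mul_inv
  rw [inv_neg] at hsum_inv hsum_mul_inv
  refine two_ne_zero (α := ℂ) ?_
  linear_combination (v⁻¹ + w⁻¹) * h.sum - hsum_inv - mul_inv_cancel₀ h.swap_halves.ne_zero -
    mul_inv_cancel₀ h.swap_right.swap_halves.ne_zero - hsum_mul_inv -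
    2 * mul_inv_cancel₀ h.ne_zero

theorem left_ne_right (h : ReflectedRows a b v w) : a ≠ v := by
  rintro rfl
  refine add_inv_ne_neg_three h.norm_a ?_
  linear_combination a⁻¹ * h.sum + a * h.sum_inv - h.sum_mul_inv - 4 * mul_inv_cancel₀ h.ne_zero

theorem mul_ne_of_mul_eq (h : ReflectedRows a b v w) (z : ℂ) (hz : z * a = b) : z * b ≠ a := by
  intro hz'
  have hfactor : (a - b) * (a + b) = 0 := by linear_combination b * hz - a * hz'
  exact (mul_ne_zero (sub_ne_zero.2 h.left_ne) h.left_add_ne_zero) hfactor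

theorem fifth_roots_of_mul_eq (h : ReflectedRows a b v w) (haw : a * w = v)
    (hav : a * v = b ∨ a * v = w) (hbv : b * v = a ∨ b * v = w) (hbw : b * w = a ∨ b * w = v) :
    a ^ 5 = 1 ∧ b ^ 5 = 1 ∧ v ^ 5 = 1 ∧ w ^ 5 = 1 ∧ a * b = 1 ∧ v * w = 1 := by
  have hav := hav.resolve_right (h.swap_right.swap_halves.mul_ne_of_mul_eq a haw)
  have hbv := hbv.resolve_left fun hbv =>
    h.mul_ne_of_mul_eq v (by rw [mul_comm, hav]) (by rw [mul_comm, hbv])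
  have hbw := hbw.resolve_right (h.swap_halves.mul_ne_of_mul_eq b hbv)
  have ha₂v : a ^ 2 * v = 1 := by
    refine mul_left_cancel₀ h.swap_halves.ne_zero ?_
    linear_combination a * v * hav + a * hbv + haw
  have hab : a * b = 1 := by linear_combination ha₂v - a * hav
  have ha₃w : a ^ 3 * w = 1 := by linear_combination a ^ 2 * haw + ha₂v
  have ha₅ : a ^ 5 = 1 := by linear_combination (-a ^ 4) * hbw + a ^ 3 * w * hab + ha₃w
  have hb : b = a ^ 4 := by linear_combination a ^ 4 * hab - b * ha₅
  have hv : v = a ^ 3 := by linear_combination a ^ 3 * ha₂v - v * ha₅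
  have hw : w = a ^ 2 := by linear_combination a ^ 2 * ha₃w - w * ha₅
  have hpow : ∀ k, (a ^ k) ^ 5 = 1 := fun k => by rw [pow_right_comm, ha₅, one_pow]
  refine ⟨ha₅, hb ▸ hpow 4, hv ▸ hpow 3, hw ▸ hpow 2, hab, ?_⟩
  rw [hv, hw, ← pow_add, ha₅]

theorem fifth_roots (h : ReflectedRows a b v w) (haw : a * w = b ∨ a * w = v)
    (hav : a * v = b ∨ a * v = w) (hbv : b * v = a ∨ b * v = w) (hbw : b * w = a ∨ b * w = v) :
    a ^ 5 = 1 ∧ b ^ 5 = 1 ∧ v ^ 5 = 1 ∧ w ^ 5 = 1 ∧ a * b = 1 ∧ v * w = 1 := by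
  rcases haw with haw | haw
  · have hbw' := hbw.resolve_left fun hbw =>
      h.mul_ne_of_mul_eq w (by rw [mul_comm, haw]) (by rw [mul_comm, hbw])
    have hbv' := hbv.resolve_right (h.swap_right.swap_halves.mul_ne_of_mul_eq b hbw')
    have hav' := hav.resolve_left fun hav =>
      h.mul_ne_of_mul_eq v (by rw [mul_comm, hav]) (by rw [mul_comm, hbv'])
    obtain ⟨ha, hb, hw, hv, hab, hwv⟩ := h.swap_right.fifth_roots_of_mul_eq hav' (.inl haw) hbw hbv
    exact ⟨ha, hb, hv, hw, hab, mul_comm v w ▸ hwv⟩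
  · exact h.fifth_roots_of_mul_eq haw hav hbv hbw

end ReflectedRows

theorem HasSymmetricCorner.reflected_row (hc : HasSymmetricCorner g) (hg : IsComplexHadamard g) :
    g 2 3 = g 1 4 ∧ g 2 4 = g 1 3 := by
  have hrow₁ := hg.sum_row_eq_zero hc.toIsDephased (i := 1) (by decide)
  have hrow₂ := hg.sum_row_eq_zero hc.toIsDephased (i := 2) (by decide)
  have hinv₁ := hg.sum_inv_row_eq_zero hc.toIsDephased (i := 1) (by decide)
  have hinv₂ := hg.sum_inv_row_eq_zero hc.toIsDephased (i := 2) (by decide)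
  have horth := hg.sum_mul_inv_eq_zero (i := 1) (i' := 2) (by decide)
  simp only [Fin.sum_univ_five, hc.col_zero, inv_one, mul_one, ← hc.apply_one_two,
    ← hc.apply_one_one] at hrow₁ hrow₂ hinv₁ hinv₂ horth
  have hmul_inv : ∀ i j, g i j * (g i j)⁻¹ = 1 := fun i j => mul_inv_cancel₀ (hg.ne_zero i j)
  have hne : g 1 3 + g 1 4 ≠ 0 := fun hzero => by
    have e14 : g 1 4 = -g 1 3 := by linear_combination hzero
    have e24 : g 2 4 = -g 2 3 := by linear_combination hrow₂ - hrow₁ + hzero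
    rw [e14, inv_neg] at hinv₁
    rw [e14, e24, inv_neg] at horth
    refine mul_ne_zero (hg.ne_zero 1 3) (inv_ne_zero (hg.ne_zero 2 3)) ?_
    linear_combination (horth - ((g 1 1)⁻¹ + (g 1 2)⁻¹) * (hrow₁ - hzero) + hinv₁ + hmul_inv 1 1 +
      hmul_inv 1 2) / 2
  refine (pair_eq_of_add_eq (hg.ne_zero _ _) (hg.ne_zero _ _) (hg.ne_zero _ _) (hg.ne_zero _ _)
    (by linear_combination hrow₂ - hrow₁) (by linear_combination hinv₂ - hinv₁) hne).resolve_left ?_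
  rintro ⟨e23, e24⟩
  rw [e23, e24] at horth
  refine add_inv_ne_neg_three (z := g 1 1 * (g 1 2)⁻¹) (by simp [hg.1]) ?_
  rw [mul_inv, inv_inv]
  linear_combination horth - hmul_inv 1 3 - hmul_inv 1 4

theorem HasSymmetricCorner.reflectedRows (hc : HasSymmetricCorner g) (hg : IsComplexHadamard g) :
    ReflectedRows (g 1 1) (g 1 2) (g 1 3) (g 1 4) where
  norm_a := hg.1 _ _
  norm_b := hg.1 _ _
  norm_v := hg.1 _ _
  norm_w := hg.1 _ _
  sum := by simpa [Fin.sum_univ_five, hc.col_zero] using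
    hg.sum_row_eq_zero hc.toIsDephased (i := 1) (by decide)
  sum_inv := by simpa [Fin.sum_univ_five, hc.col_zero] using
    hg.sum_inv_row_eq_zero hc.toIsDephased (i := 1) (by decide)
  sum_mul_inv := by
    obtain ⟨e23, e24⟩ := hc.reflected_row hg
    simpa [Fin.sum_univ_five, hc.col_zero, ← hc.apply_one_two, ← hc.apply_one_one, e23, e24] using
      hg.sum_mul_inv_eq_zero (i := 1) (i' := 2) (by decide)

theorem exists_perm_apply_one_and_two {j k : Fin 5} (hj : j ≠ 0) (hk : k ≠ 0) (hjk : j ≠ k) :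
    ∃ t : Equiv.Perm (Fin 5), t 0 = 0 ∧ t 1 = j ∧ t 2 = k := by
  revert j k
  decide

theorem mul_eq_or_of_apply_ne (hg : IsComplexHadamard g) (hd : IsDephased g) {j k : Fin 5}
    (hj : j ≠ 0) (hk : k ≠ 0) (hjk : j ≠ k) (hne : g 1 k ≠ g 2 j) :
    g 1 j * g 2 k = g 2 j ∨ g 1 j * g 2 k = g 1 k := by
  obtain ⟨t, ht, rfl, rfl⟩ := exists_perm_apply_one_and_two hj hk hjk
  rcases corner_products_coincide (hg.submatrix 1 t) (hd.submatrix rfl ht) with h | h | h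
  exacts [.inr h, (hne h).elim, .inl h.symm]

theorem HasSymmetricCorner.fifth_roots (hc : HasSymmetricCorner g) (hg : IsComplexHadamard g) :
    g 1 1 ^ 5 = 1 ∧ g 1 2 ^ 5 = 1 ∧ g 1 3 ^ 5 = 1 ∧ g 1 4 ^ 5 = 1 ∧ g 1 1 * g 1 2 = 1 ∧
      g 1 3 * g 1 4 = 1 := by
  have h := hc.reflectedRows hg
  have hmul := @mul_eq_or_of_apply_ne g hg hc.toIsDephased
  obtain ⟨e23, -⟩ := hc.reflected_row hg
  have e21 := hc.apply_one_two.symm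
  have e22 := hc.apply_one_one.symm
  refine h.fifth_roots ?_ ?_ ?_ ?_
  · simpa only [e21, e23] using @hmul 1 3 (by decide) (by decide) (by decide)
      (e21 ▸ h.swap_left.left_ne_right.symm)
  · simpa only [e22, e23, mul_comm, or_comm] using @hmul 3 2 (by decide) (by decide) (by decide)
      (e23 ▸ h.swap_left.swap_right.left_ne_right)
  · simpa only [e21, e23, mul_comm, or_comm] using @hmul 3 1 (by decide) (by decide) (by decide)
      (e23 ▸ h.swap_right.left_ne_right)
  · simpa only [e22, e23] using @hmul 2 3 (by decide) (by decide) (by decide)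
      (e22 ▸ h.left_ne_right.symm)

theorem HasSymmetricCorner.row_one_pow_five (hc : HasSymmetricCorner g)
    (hg : IsComplexHadamard g) (j : Fin 5) : g 1 j ^ 5 = 1 := by
  obtain ⟨ha, hb, hv, hw, -, -⟩ := hc.fifth_roots hg
  fin_cases j
  exacts [by simp [hc.col_zero], ha, hb, hv, hw]

theorem HasSymmetricCorner.row_one_mul_row_two (hc : HasSymmetricCorner g)
    (hg : IsComplexHadamard g) (j : Fin 5) : g 1 j * g 2 j = 1 := by
  obtain ⟨-, -, -, -, hab, hvw⟩ := hc.fifth_roots hg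
  obtain ⟨e23, e24⟩ := hc.reflected_row hg
  fin_cases j <;>
    simp [hc.col_zero, ← hc.apply_one_two, ← hc.apply_one_one, e23, e24, hab, hvw,
      mul_comm (g 1 2), mul_comm (g 1 4)]

theorem HasSymmetricCorner.row_one_injective (hc : HasSymmetricCorner g)
    (hg : IsComplexHadamard g) : Function.Injective (g 1) := by
  have h := hc.reflectedRows hg
  obtain ⟨-, -, -, -, hab, hvw⟩ := hc.fifth_roots hg
  have hne_one : ∀ {a b : ℂ}, a * b = 1 → a ≠ b → 1 ≠ a ∧ 1 ≠ b := by
    rintro a b hab hne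
    constructor <;> rintro rfl <;> simp_all
  obtain ⟨ha, hb⟩ := hne_one hab h.left_ne
  obtain ⟨hv, hw⟩ := hne_one hvw h.swap_halves.left_ne
  have hlt : ∀ j k : Fin 5, j < k → g 1 j ≠ g 1 k := by
    intro j k hjk
    fin_cases j <;> fin_cases k <;> first | exact absurd hjk (by decide) | skip
    exacts [hc.col_zero 1 ▸ ha, hc.col_zero 1 ▸ hb, hc.col_zero 1 ▸ hv, hc.col_zero 1 ▸ hw,
      h.left_ne, h.left_ne_right, h.swap_right.left_ne_right, h.swap_left.left_ne_right,
      h.swap_left.swap_right.left_ne_right, h.swap_halves.left_ne]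
  intro j k hjk
  by_contra hne
  rcases lt_or_gt_of_ne hne with h | h
  exacts [hlt j k h hjk, hlt k j h hjk.symm]

theorem geom_sum_five_eq_zero {R : Type*} [CommRing R] [IsDomain R] {z : R} (hz : z ^ 5 = 1)
    (hz1 : z ≠ 1) : 1 + z + z ^ 2 + z ^ 3 + z ^ 4 = 0 := by
  have hfactor : (z - 1) * (1 + z + z ^ 2 + z ^ 3 + z ^ 4) = 0 := by linear_combination hz
  exact (mul_eq_zero.1 hfactor).resolve_left (sub_ne_zero.2 hz1)

theorem pair_eq_sq_and_cube_of_sum_eq_zero {z p q : ℂ} (hz : z ^ 5 = 1) (hz1 : z ≠ 1) (hp : p ≠ 0)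
    (hq : q ≠ 0) (h : 1 + z + z⁻¹ + p + q = 0) (h' : 1 + z + z⁻¹ + p⁻¹ + q⁻¹ = 0) :
    p = z ^ 2 ∧ q = z ^ 3 ∨ p = z ^ 3 ∧ q = z ^ 2 := by
  have hgeom := geom_sum_five_eq_zero hz hz1
  have hz0 : z ≠ 0 := by
    rintro rfl
    norm_num at hz
  have hinv : z⁻¹ = z ^ 4 := inv_eq_of_mul_eq_one_right (by linear_combination hz)
  have hinv₂ : (z ^ 2)⁻¹ = z ^ 3 := inv_eq_of_mul_eq_one_right (by linear_combination hz)
  have hinv₃ : (z ^ 3)⁻¹ = z ^ 2 := inv_eq_of_mul_eq_one_right (by linear_combination hz)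
  refine pair_eq_of_add_eq hp hq (pow_ne_zero 2 hz0) (pow_ne_zero 3 hz0)
    (by linear_combination h - hgeom - hinv)
    (by linear_combination h' - hgeom - hinv - hinv₂ - hinv₃) fun hsum => ?_
  have hzneg : z = -1 := mul_left_cancel₀ (pow_ne_zero 2 hz0) (by linear_combination hsum)
  norm_num [hzneg] at hz

theorem HasSymmetricCorner.row_three_four_mul_inv (hc : HasSymmetricCorner g)
    (hg : IsComplexHadamard g) {j k : Fin 5} (hjk : j ≠ k) :
    g 3 j * (g 3 k)⁻¹ = (g 1 j * (g 1 k)⁻¹) ^ 2 ∧ g 4 j * (g 4 k)⁻¹ = (g 1 j * (g 1 k)⁻¹) ^ 3 ∨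
      g 3 j * (g 3 k)⁻¹ = (g 1 j * (g 1 k)⁻¹) ^ 3 ∧
        g 4 j * (g 4 k)⁻¹ = (g 1 j * (g 1 k)⁻¹) ^ 2 := by
  have hne := hg.ne_zero
  have hrow₂ : ∀ j, g 2 j = (g 1 j)⁻¹ := fun j =>
    (inv_eq_of_mul_eq_one_right (hc.row_one_mul_row_two hg j)).symm
  have hcol : ∀ {j k : Fin 5}, j ≠ k → 1 + g 1 j * (g 1 k)⁻¹ + (g 1 j * (g 1 k)⁻¹)⁻¹ +
      g 3 j * (g 3 k)⁻¹ + g 4 j * (g 4 k)⁻¹ = 0 := fun {j k} hjk => by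
    simpa only [Fin.sum_univ_five, transpose_apply, hc.row_zero, hrow₂, inv_one, mul_one, mul_inv]
      using hg.transpose.sum_mul_inv_eq_zero hjk
  refine pair_eq_sq_and_cube_of_sum_eq_zero ?_ ?_ (mul_ne_zero (hne _ _) (inv_ne_zero (hne _ _)))
    (mul_ne_zero (hne _ _) (inv_ne_zero (hne _ _))) (hcol hjk) ?_
  · rw [mul_pow, inv_pow, hc.row_one_pow_five hg, hc.row_one_pow_five hg, inv_one, mul_one]
  · rw [← div_eq_mul_inv, Ne, div_eq_one_iff_eq (hne _ _)]
    exact (hc.row_one_injective hg).ne hjk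
  · have := hcol hjk.symm
    simp only [mul_inv, inv_inv] at this ⊢
    linear_combination this

theorem HasSymmetricCorner.rows_three_four (hc : HasSymmetricCorner g)
    (hg : IsComplexHadamard g) (j : Fin 5) :
    g 3 j = g 1 j ^ 2 ∧ g 4 j = g 1 j ^ 3 ∨ g 3 j = g 1 j ^ 3 ∧ g 4 j = g 1 j ^ 2 := by
  rcases eq_or_ne j 0 with rfl | hj
  · simp [hc.col_zero]
  · simpa [hc.col_zero] using hc.row_three_four_mul_inv hg hj

theorem HasSymmetricCorner.rows_three_four_uniform (hc : HasSymmetricCorner g)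
    (hg : IsComplexHadamard g) :
    (∀ j, g 3 j = g 1 j ^ 2 ∧ g 4 j = g 1 j ^ 3) ∨ ∀ j, g 3 j = g 1 j ^ 3 ∧ g 4 j = g 1 j ^ 2 := by
  by_contra! hmixed
  obtain ⟨⟨j, hj⟩, k, hk⟩ := hmixed
  have hj₃ := (hc.rows_three_four hg j).resolve_left fun h => hj h.1 h.2
  have hk₂ := (hc.rows_three_four hg k).resolve_right fun h => hk h.1 h.2
  have hj1 : g 1 j ≠ 1 := fun h => by simp_all
  have hk1 : g 1 k ≠ 1 := fun h => by simp_all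
  have hjk : j ≠ k := by
    rintro rfl
    exact hj hk₂.1 hk₂.2
  have hj0 := hg.ne_zero 1 j
  have hk0 := hg.ne_zero 1 k
  rcases hc.row_three_four_mul_inv hg hjk with ⟨h, -⟩ | ⟨h, -⟩ <;> rw [hj₃.1, hk₂.1] at h <;>
    field_simp at h
  exacts [hj1 h, hk1 h]

theorem hadamardSimilar_fourierMatrix_of_hasSymmetricCorner (hg : IsComplexHadamard g)
    (hc : HasSymmetricCorner g) : HadamardSimilar (fourierMatrix 5) g := by
  have hrow₂ : ∀ j, g 2 j = g 1 j ^ 4 := fun j => by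
    linear_combination g 1 j ^ 4 * hc.row_one_mul_row_two hg j - g 2 j * hc.row_one_pow_five hg j
  refine hg.hadamardSimilar_fourierMatrix (hc.row_one_pow_five hg) fun i => ?_
  rcases hc.rows_three_four_uniform hg with h | h <;> fin_cases i
  exacts [⟨0, hc.row_zero⟩, ⟨1, fun j => (pow_one _).symm⟩, ⟨4, hrow₂⟩, ⟨2, fun j => (h j).1⟩,
    ⟨3, fun j => (h j).2⟩, ⟨0, hc.row_zero⟩, ⟨1, fun j => (pow_one _).symm⟩, ⟨4, hrow₂⟩,
    ⟨3, fun j => (h j).1⟩, ⟨2, fun j => (h j).2⟩]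

theorem hadamardSimilar_fourierMatrix_five (hh : IsComplexHadamard h) :
    HadamardSimilar (fourierMatrix 5) h := by
  obtain ⟨g, hg, hc, hgh⟩ := exists_hasSymmetricCorner_similar hh
  exact (hadamardSimilar_fourierMatrix_of_hasSymmetricCorner hg hc).trans hgh

end OrderFive

section Pairs

open Matrix Module

variable {n : ℕ} {A B A' B' : Matrix (Fin n) (Fin n) ℂ}
  {e ζ : Basis (Fin n) ℂ (EuclideanSpace ℂ (Fin n))}

theorem PairUnitarilyEquivalent.trace_mul_sq (h : PairUnitarilyEquivalent A B A' B') :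
    ((A * B) ^ 2).trace = ((A' * B') ^ 2).trace := by
  obtain ⟨U, hU, rfl, rfl⟩ := h
  have hUU : Uᴴ * U = 1 := mem_unitaryGroup_iff'.1 hU
  calc ((U * A' * Uᴴ * (U * B' * Uᴴ)) ^ 2).trace
      = (U * (A' * (Uᴴ * U) * B' * (Uᴴ * U) * A' * (Uᴴ * U) * B' * Uᴴ)).trace := by
        simp only [sq, Matrix.mul_assoc]
    _ = (A' * B' * A' * B' * (Uᴴ * U)).trace := by
        rw [trace_mul_comm]
        simp only [hUU, Matrix.mul_one, Matrix.mul_assoc]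
    _ = ((A' * B') ^ 2).trace := by rw [hUU, Matrix.mul_one, sq, Matrix.mul_assoc (A' * B')]

theorem orthonormal_of_apply_eq_unityRoot_smul (hA : A ∈ unitaryGroup (Fin n) ℂ)
    (he : ∀ j, ‖e j‖ = 1) (hAe : ∀ j, toEuclideanLin A (e j) = unityRoot n j • e j) :
    Orthonormal ℂ e :=
  orthonormal_of_mem_unitaryGroup hA (unityRoot_injective n) (fun j => norm_unityRoot n j) he hAe

theorem exists_orthonormal_unityRoot_eigenbasis (hn : n ≠ 0) (hA : A ∈ unitaryGroup (Fin n) ℂ)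
    (hs : spectrum ℂ A = {w : ℂ | w ^ n = 1}) :
    ∃ e : Basis (Fin n) ℂ (EuclideanSpace ℂ (Fin n)), Orthonormal ℂ e ∧
      ∀ j, toEuclideanLin A (e j) = unityRoot n j • e j :=
  exists_orthonormal_eigenbasis hA (unityRoot_injective n) (fun j => norm_unityRoot n j)
    fun j => hs ▸ unityRoot_pow_eq_one hn j

theorem hadamardPartner_sqrt_smul (hn : n ≠ 0) (h : Matrix (Fin n) (Fin n) ℂ) :
    hadamardPartner ((Real.sqrt n : ℂ) • h) = hᴴ * unityDiagonal n * h := by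
  have hsqrt : (Real.sqrt n : ℂ) * (Real.sqrt n : ℂ) = n := by
    rw [← Complex.ofReal_mul, Real.mul_self_sqrt n.cast_nonneg, Complex.ofReal_natCast]
  rw [hadamardPartner, conjTranspose_smul, RCLike.star_def, Complex.conj_ofReal, Matrix.smul_mul,
    Matrix.smul_mul, Matrix.mul_smul, smul_smul, smul_smul, mul_assoc, hsqrt,
    inv_mul_cancel₀ (Nat.cast_ne_zero.2 hn), one_smul]

theorem pairUnitarilyEquivalent_hadamardPartner (hn : n ≠ 0) (he : Orthonormal ℂ e)
    (hζ : Orthonormal ℂ ζ) (hAe : ∀ j, toEuclideanLin A (e j) = unityRoot n j • e j)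
    (hBζ : ∀ j, toEuclideanLin B (ζ j) = unityRoot n j • ζ j) :
    PairUnitarilyEquivalent A B (unityDiagonal n)
      (hadamardPartner ((Real.sqrt n : ℂ) • ζ.toMatrix e)) := by
  have hβ := (EuclideanSpace.basisFun (Fin n) ℂ).orthonormal
  rw [← OrthonormalBasis.coe_toBasis] at hβ
  refine ⟨_, toMatrix_mem_unitaryGroup_of_orthonormal hβ he, ?_, ?_⟩ <;>
    rw [conjTranspose_toMatrix_of_orthonormal hβ he]
  · exact eq_toMatrix_mul_diagonal_mul_toMatrix hAe
  · rw [hadamardPartner_sqrt_smul hn, conjTranspose_toMatrix_of_orthonormal hζ he,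
      eq_toMatrix_mul_diagonal_mul_toMatrix hBζ, ← Basis.toMatrix_mul_toMatrix _ e ζ,
      ← Basis.toMatrix_mul_toMatrix ζ e]
    simp only [Matrix.mul_assoc]
    rfl

theorem isComplexHadamard_sqrt_smul_toMatrix (hn : n ≠ 0)
    (hσ : properJointSpectrum ![A, B, A * B] = fourierSurface n) (he : Orthonormal ℂ e)
    (hζ : Orthonormal ℂ ζ) (hAe : ∀ j, toEuclideanLin A (e j) = unityRoot n j • e j)
    (hBζ : ∀ j, toEuclideanLin B (ζ j) = unityRoot n j • ζ j) :
    IsComplexHadamard ((Real.sqrt n : ℂ) • ζ.toMatrix e) ∧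
      IsComplexHadamard ((Real.sqrt n : ℂ) • e.toMatrix ζ) := by
  have hX := toMatrix_mem_unitaryGroup_of_orthonormal he hζ
  have hentry := card_mul_norm_sq_apply_eq_one hn hX fun x y z => by
    rw [← det_one_sub_eq_of_properJointSpectrum_eq hn hσ]
    exact det_sub_of_eigenbases hAe hBζ x y z
  refine ⟨.sqrt_smul_of_mem_unitaryGroup (toMatrix_mem_unitaryGroup_of_orthonormal hζ he)
    fun i j => ?_, .sqrt_smul_of_mem_unitaryGroup hX hentry⟩
  rw [← conjTranspose_toMatrix_of_orthonormal he hζ, conjTranspose_apply, norm_star, hentry]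

theorem hadamardSimilar_fourierMatrix_sqrt_smul_toMatrix (hn : n = 3 ∨ n = 4 ∨ n = 5)
    (hσ : properJointSpectrum ![A, B, A * B] = fourierSurface n) (he : Orthonormal ℂ e)
    (hζ : Orthonormal ℂ ζ) (hAe : ∀ j, toEuclideanLin A (e j) = unityRoot n j • e j)
    (hBζ : ∀ j, toEuclideanLin B (ζ j) = unityRoot n j • ζ j) :
    HadamardSimilar (fourierMatrix n) ((Real.sqrt n : ℂ) • ζ.toMatrix e) := by
  have hn0 : n ≠ 0 := by omega
  have hχ : (A * B).charpoly = Polynomial.X ^ n - Polynomial.C ((-1) ^ (n - 1)) := by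
    simpa [hn0] using charpoly_eq_of_properJointSpectrum_eq hn0 hσ 0 0 1
  have hh := (isComplexHadamard_sqrt_smul_toMatrix hn0 hσ he hζ hAe hBζ).1
  have hpair := pairUnitarilyEquivalent_hadamardPartner hn0 he hζ hAe hBζ
  rcases hn with rfl | rfl | rfl
  · exact hadamardSimilar_fourierMatrix_three hh
  · exact hadamardSimilar_fourierMatrix_four hh <|
      hpair.trace_mul_sq.symm.trans (trace_sq_eq_zero_of_charpoly_eq (by decide : 2 < 4) hχ)
  · exact hadamardSimilar_fourierMatrix_five hh

end Pairs

theorem mainTheorem2 (n : ℕ) (A B : Matrix (Fin n) (Fin n) ℂ)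
    (hA : IsStarNormal A)
    (hB : ‖Matrix.toEuclideanCLM (n := Fin n) (𝕜 := ℂ) B‖ = 1)
    (hσ : properJointSpectrum ![A, B, A * B] = fourierSurface n) :
    (A ∈ Matrix.unitaryGroup (Fin n) ℂ ∧ B ∈ Matrix.unitaryGroup (Fin n) ℂ ∧
      spectrum ℂ A = {w : ℂ | w ^ n = 1} ∧
      spectrum ℂ B = {w : ℂ | w ^ n = 1} ∧
      (∀ w ∈ spectrum ℂ A, A.charpoly.rootMultiplicity w = 1) ∧
      (∀ w ∈ spectrum ℂ B, B.charpoly.rootMultiplicity w = 1)) ∧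
    (∀ e ζ : Module.Basis (Fin n) ℂ (EuclideanSpace ℂ (Fin n)),
      (∀ j, ‖e j‖ = 1) → (∀ j, ‖ζ j‖ = 1) →
      (∀ j, Matrix.toEuclideanLin A (e j) = unityRoot n j • e j) →
      (∀ j, Matrix.toEuclideanLin B (ζ j) = unityRoot n j • ζ j) →
      IsComplexHadamard ((Real.sqrt n : ℂ) • ζ.toMatrix e) ∧
      IsComplexHadamard ((Real.sqrt n : ℂ) • e.toMatrix ζ)) ∧
    (n = 3 ∨ n = 4 ∨ n = 5 →
      ∃ h : Matrix (Fin n) (Fin n) ℂ, IsComplexHadamard h ∧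
        HadamardSimilar (fourierMatrix n) h ∧
        PairUnitarilyEquivalent A B (unityDiagonal n) (hadamardPartner h)) := by
  have hn : n ≠ 0 := by
    rintro rfl
    rw [Subsingleton.elim B 0, map_zero, norm_zero] at hB
    exact zero_ne_one hB
  have hn' : (n : ℂ) ≠ 0 := Nat.cast_ne_zero.2 hn
  have hχ := charpoly_eq_of_properJointSpectrum_eq hn hσ
  have hχA : A.charpoly = Polynomial.X ^ n - 1 := by simpa [hn] using hχ 1 0 0
  have hχB : B.charpoly = Polynomial.X ^ n - 1 := by simpa [hn] using hχ 0 1 0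
  have hAu := mem_unitaryGroup_of_isStarNormal_of_pow_eq_one hn hA (pow_eq_one_of_charpoly_eq hχA)
  have hBu :=
    mem_unitaryGroup_of_opNorm_le_one_of_pow_eq_one hn hB.le (pow_eq_one_of_charpoly_eq hχB)
  have hsA := spectrum_eq_of_charpoly_eq hχA
  have hsB := spectrum_eq_of_charpoly_eq hχB
  refine ⟨⟨hAu, hBu, hsA, hsB, fun w => rootMultiplicity_charpoly_eq_one hn' hχA,
    fun w => rootMultiplicity_charpoly_eq_one hn' hχB⟩, fun e ζ he hζ hAe hBζ =>
      isComplexHadamard_sqrt_smul_toMatrix hn hσ (orthonormal_of_apply_eq_unityRoot_smul hAu he hAe)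
        (orthonormal_of_apply_eq_unityRoot_smul hBu hζ hBζ) hAe hBζ, fun hcases => ?_⟩
  obtain ⟨e, he, hAe⟩ := exists_orthonormal_unityRoot_eigenbasis hn hAu hsA
  obtain ⟨ζ, hζ, hBζ⟩ := exists_orthonormal_unityRoot_eigenbasis hn hBu hsB
  exact ⟨_, (isComplexHadamard_sqrt_smul_toMatrix hn hσ he hζ hAe hBζ).1,
    hadamardSimilar_fourierMatrix_sqrt_smul_toMatrix hcases hσ he hζ hAe hBζ,
    pairUnitarilyEquivalent_hadamardPartner hn he hζ hAe hBζ⟩
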